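/- Let $\mathcal H$ be a separable infinite-dimensional complex Hilbert space, let $B(\mathcal H)$ be the bounded operators on $\mathcal H$, let $K(\mathcal H)\subseteq B(\mathcal H)$ be the ideal of compact operators, let $\mathcal Q(\mathcal H)=B(\mathcal H)/K(\mathcal H)$ be the Calkin algebra, and let $\pi:B(\mathcal H)\to\mathcal Q(\mathcal H)$ be the quotient map. An operator subsystem of a unital $C^*$-algebra $\mathcal D$ is a linear subspace $\mathcal S\subseteq\mathcal D$ with $1\in\mathcal S$ and $\mathcal S^*=\mathcal S$. A linear map $\varphi:\mathcal S\to\mathcal B$ into a unital $C^*$-algebra is ucp if $\varphi(1)=1$ and, for every $k$, applying $\varphi$ entrywise sends every element of $M_k(\mathcal S)$ that is positive in $M_k(\mathcal D)$ to a positive element of $M_k(\mathcal B)$. If $q:\mathcal B\to\mathcal C$ is the quotient map onto a quotient $C^*$-algebra, a ucp lift to $\mathcal B$ of a map $\varphi:\mathcal S\to\mathcal C$ is a ucp map $\psi:\mathcal S\to\mathcal B$ with $q\circ\psi=\varphi$. The system $\mathcal S$ has the lifting property if, for every unital $C^*$-algebra $\mathcal B$ and every closed two-sided ideal $\mathcal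 I$ of $\mathcal B$, every ucp map $\mathcal S\to\mathcal B/\mathcal I$ has a ucp lift to $\mathcal B$. **Theorem.** Let $\mathcal A$ be a unital $C^*$-algebra that is generated, as a unital $C^*$-algebra, by a finite set, and let $\rho:\mathcal A\to\mathcal Q(\mathcal H)$ be a unital $*$-homomorphism that has no ucp lift to $B(\mathcal H)$. Then there are an integer $n\ge 1$ and an operator subsystem $\mathcal S$ of $M_{n+1}(\mathcal A)=\mathcal A\otimes M_{n+1}$ with $\dim_{\mathbb C}\mathcal S=4$ such that the restriction $$(\rho\otimes\mathrm{id}_{n+1})|_{\mathcal S}:\mathcal S\to\mathcal Q(\mathcal H)\otimes M_{n+1}$$ has no ucp lift to $B(\mathcal H)\otimes M_{n+1}$ along $\pi\otimes\mathrm{id}_{n+1}$. In particular, $\mathcal S$ does not have the lifting property. -/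

import Mathlib

open scoped CStarAlgebra

universe u v

noncomputable section

/-! ## Quotients of C⋆-algebras by closed two-sided ideals -/

namespace CStarQuotient

variable {B : Type*} [CStarAlgebra B] (I : Ideal B)

/-- Approximate units: a self-adjoint `i ∈ I` is almost annihilated by some contraction `d`
with `1 - d ∈ I`. -/
theorem exists_approx {i : B} (hi : i ∈ I) (hsa : IsSelfAdjoint i) {ε : ℝ} (hε : 0 < ε) :
    ∃ d : B, IsSelfAdjoint d ∧ ‖d‖ ≤ 1 ∧ 1 - d ∈ I ∧ ‖d * i * d‖ ≤ ε := by
  have hpos : ∀ t : ℝ, 0 < t ^ 2 + ε ^ 2 := fun t => by positivity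
  have hf : Continuous fun t : ℝ => ε ^ 2 / (t ^ 2 + ε ^ 2) :=
    Continuous.div (by fun_prop) (by fun_prop) fun t => (hpos t).ne'
  have hg : Continuous fun t : ℝ => t / (t ^ 2 + ε ^ 2) :=
    Continuous.div (by fun_prop) (by fun_prop) fun t => (hpos t).ne'
  have hfb : ∀ t : ℝ, ‖ε ^ 2 / (t ^ 2 + ε ^ 2)‖ ≤ 1 := fun t => by
    rw [Real.norm_of_nonneg (by positivity), div_le_one (hpos t)]
    nlinarith [sq_nonneg t]
  have hd : ‖cfc (fun t : ℝ => ε ^ 2 / (t ^ 2 + ε ^ 2)) i‖ ≤ 1 :=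
    norm_cfc_le zero_le_one fun t _ => hfb t
  refine ⟨cfc (fun t : ℝ => ε ^ 2 / (t ^ 2 + ε ^ 2)) i, cfc_predicate _ i, hd, ?_, ?_⟩
  · have h1 : (1 : B) - cfc (fun t : ℝ => ε ^ 2 / (t ^ 2 + ε ^ 2)) i
        = cfc (fun t : ℝ => t / (t ^ 2 + ε ^ 2)) i * i := by
      rw [← cfc_one ℝ i (ha := hsa), show (1 : ℝ → ℝ) = fun _ => 1 from rfl]
      conv_rhs => rhs; rw [← cfc_id' ℝ i (ha := hsa)]
      rw [← cfc_sub (fun _ : ℝ => (1 : ℝ)) _ i (by fun_prop) hf.continuousOn,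
        ← cfc_mul _ _ i hg.continuousOn (by fun_prop)]
      refine cfc_congr fun t _ => ?_
      have := (hpos t).ne'
      field_simp
      ring
    rw [h1]
    exact I.mul_mem_left _ hi
  · have h2 : cfc (fun t : ℝ => ε ^ 2 / (t ^ 2 + ε ^ 2)) i * i
        = cfc (fun t : ℝ => ε ^ 2 / (t ^ 2 + ε ^ 2) * t) i := by
      conv_lhs => rhs; rw [← cfc_id' ℝ i (ha := hsa)]
      rw [← cfc_mul _ _ i hf.continuousOn (by fun_prop)]
    have h3 : ‖cfc (fun t : ℝ => ε ^ 2 / (t ^ 2 + ε ^ 2) * t) i‖ ≤ ε := by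
      refine norm_cfc_le hε.le fun t _ => ?_
      rw [Real.norm_eq_abs, abs_mul, abs_of_pos (div_pos (by positivity) (hpos t)),
        div_mul_eq_mul_div, div_le_iff₀ (hpos t)]
      nlinarith [sq_abs t, sq_nonneg (|t| - ε), abs_nonneg t,
        mul_nonneg hε.le (sq_nonneg (|t| - ε)), mul_nonneg hε.le (sq_nonneg t)]
    rw [h2]
    calc _ ≤ _ := norm_mul_le _ _
      _ ≤ ε * 1 := by gcongr
      _ = ε := mul_one ε

variable [I.IsTwoSided]

/-- A closed two-sided ideal of a C⋆-algebra is automatically self-adjoint. -/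
theorem star_mem [hI : IsClosed (I : Set B)] {x : B} (hx : x ∈ I) : star x ∈ I := by
  have : star x ∈ closure (I : Set B) := by
    rw [Metric.mem_closure_iff]
    intro ε hε
    obtain ⟨d, hd, -, hdI, hn⟩ := exists_approx I (I.mul_mem_right (star x) hx)
      (IsSelfAdjoint.mul_star_self x) (ε := (ε / 2) ^ 2) (by positivity)
    refine ⟨star x * (1 - d), I.mul_mem_left _ hdI, ?_⟩
    rw [dist_eq_norm, show star x - star x * (1 - d) = star x * d by noncomm_ring]
    have h := CStarRing.norm_star_mul_self (x := star x * d)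
    rw [star_mul, star_star, hd.star_eq, ← mul_assoc, mul_assoc d] at h
    nlinarith [norm_nonneg (star x * d)]
  rwa [hI.closure_eq] at this

instance instStar [IsClosed (I : Set B)] : Star (B ⧸ I) where
  star := Quotient.map' star fun a b h => by
    rw [Submodule.quotientRel_def] at h ⊢
    rw [← star_sub]
    exact star_mem I h

@[simp]
theorem star_mk [IsClosed (I : Set B)] (x : B) :
    star (Ideal.Quotient.mk I x) = Ideal.Quotient.mk I (star x) := rfl

theorem norm_mk_le (x : B) : ‖Ideal.Quotient.mk I x‖ ≤ ‖x‖ := Submodule.Quotient.norm_mk_le I x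

theorem exists_lift_norm_lt (x : B ⧸ I) {ε : ℝ} (hε : 0 < ε) :
    ∃ b : B, Ideal.Quotient.mk I b = x ∧ ‖b‖ < ‖x‖ + ε :=
  Submodule.Quotient.norm_mk_lt x hε

instance instStarRing [IsClosed (I : Set B)] : StarRing (B ⧸ I) where
  star_involutive x := by
    obtain ⟨x, rfl⟩ := Ideal.Quotient.mk_surjective x
    simp
  star_mul x y := by
    obtain ⟨x, rfl⟩ := Ideal.Quotient.mk_surjective x
    obtain ⟨y, rfl⟩ := Ideal.Quotient.mk_surjective y
    rw [← map_mul, star_mk, star_mul, map_mul]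
    rfl
  star_add x y := by
    obtain ⟨x, rfl⟩ := Ideal.Quotient.mk_surjective x
    obtain ⟨y, rfl⟩ := Ideal.Quotient.mk_surjective y
    rw [← map_add, star_mk, star_add, map_add]
    rfl

/-- The quotient norm, with the quotient multiplication. -/
instance instNormedRing [IsClosed (I : Set B)] : NormedRing (B ⧸ I) where
  __ := Ideal.Quotient.ring I
  __ := Submodule.Quotient.normedAddCommGroup I
  norm_mul_le x y := by
    have key : ∀ ε : ℝ, 0 < ε → ‖x * y‖ ≤ (‖x‖ + ε) * (‖y‖ + ε) := fun ε hε => by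
      obtain ⟨a, rfl, ha⟩ := exists_lift_norm_lt I x hε
      obtain ⟨b, rfl, hb⟩ := exists_lift_norm_lt I y hε
      calc ‖Ideal.Quotient.mk I a * Ideal.Quotient.mk I b‖
          = ‖Ideal.Quotient.mk I (a * b)‖ := by rw [map_mul]
        _ ≤ ‖a * b‖ := norm_mk_le I _
        _ ≤ ‖a‖ * ‖b‖ := norm_mul_le a b
        _ ≤ _ := by gcongr
    have lim : Filter.Tendsto (fun ε : ℝ => (‖x‖ + ε) * (‖y‖ + ε)) (nhdsWithin 0 (Set.Ioi 0))
        (nhds (‖x‖ * ‖y‖)) := by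
      have : Continuous fun ε : ℝ => (‖x‖ + ε) * (‖y‖ + ε) := by fun_prop
      simpa using (this.tendsto 0).mono_left nhdsWithin_le_nhds
    exact ge_of_tendsto lim (by filter_upwards [self_mem_nhdsWithin] with ε hε using key ε hε)

instance instNormedAlgebra [IsClosed (I : Set B)] : NormedAlgebra ℂ (B ⧸ I) where
  __ := Ideal.Quotient.algebra ℂ
  norm_smul_le := (Submodule.Quotient.normedSpace I ℂ).norm_smul_le

theorem norm_mk_sq_le (x i : B) (hi : i ∈ I) [IsClosed (I : Set B)] :
    ‖Ideal.Quotient.mk I x‖ * ‖Ideal.Quotient.mk I x‖ ≤ ‖star x * x + i‖ := by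
  refine le_of_forall_pos_le_add fun ε hε => ?_
  set j : B := (2⁻¹ : ℂ) • (i + star i) with hj
  have hjI : j ∈ I := by
    rw [hj, Algebra.smul_def]
    exact I.mul_mem_left _ (I.add_mem hi (star_mem I hi))
  have hjsa : IsSelfAdjoint j := by
    rw [IsSelfAdjoint, hj, star_smul, star_add, star_star, add_comm (star i)]
    simp
  obtain ⟨d, hd, hd1, hdI, hn⟩ := exists_approx I hjI hjsa hε
  have hmk : Ideal.Quotient.mk I x = Ideal.Quotient.mk I (x * d) := by
    rw [Ideal.Quotient.eq, show x - x * d = x * (1 - d) by noncomm_ring]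
    exact I.mul_mem_left _ hdI
  have hy : ‖star x * x + j‖ ≤ ‖star x * x + i‖ := by
    have : star x * x + j = (2⁻¹ : ℂ) • ((star x * x + i) + star (star x * x + i)) := by
      rw [hj, star_add, star_mul, star_star,
        show star x * x + i + (star x * x + star i)
          = (2 : ℂ) • (star x * x) + (i + star i) by rw [two_smul]; abel,
        smul_add (2⁻¹ : ℂ) ((2 : ℂ) • (star x * x)), smul_smul,
        inv_mul_cancel₀ (two_ne_zero), one_smul]
    rw [this, norm_smul]
    have h := norm_add_le (star x * x + i) (star (star x * x + i))
    rw [norm_star] at h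
    rw [norm_inv, Complex.norm_ofNat]
    linarith
  calc ‖Ideal.Quotient.mk I x‖ * ‖Ideal.Quotient.mk I x‖
      ≤ ‖x * d‖ * ‖x * d‖ := by
        rw [hmk]
        gcongr <;> exact norm_mk_le I _
    _ = ‖d * (star x * x + j) * d - d * j * d‖ := by
        rw [← CStarRing.norm_star_mul_self, star_mul, hd.star_eq]
        congr 1
        noncomm_ring
    _ ≤ ‖d * (star x * x + j) * d‖ + ‖d * j * d‖ := norm_sub_le _ _
    _ ≤ ‖star x * x + i‖ + ε := by
        gcongr
        calc ‖d * (star x * x + j) * d‖ ≤ ‖d‖ * ‖star x * x + j‖ * ‖d‖ :=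
              (norm_mul_le _ _).trans (by gcongr; exact norm_mul_le _ _)
          _ ≤ 1 * ‖star x * x + i‖ * 1 := by gcongr
          _ = _ := by ring

/-- The quotient of a unital C⋆-algebra by a closed two-sided ideal is a unital C⋆-algebra. -/
instance instCStarAlgebra [IsClosed (I : Set B)] : CStarAlgebra (B ⧸ I) where
  __ := instNormedRing I
  __ := instStarRing I
  __ := instNormedAlgebra I
  __ := (Submodule.Quotient.completeSpace I : CompleteSpace (B ⧸ I))
  norm_mul_self_le x := by
    refine le_of_forall_pos_le_add fun ε hε => ?_
    obtain ⟨x, rfl⟩ := Ideal.Quotient.mk_surjective x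
    obtain ⟨b, hb, hbn⟩ := exists_lift_norm_lt I
      (star (Ideal.Quotient.mk I x) * Ideal.Quotient.mk I x) hε
    have hb' : b - star x * x ∈ I := by
      rw [← Ideal.Quotient.eq, hb, map_mul, star_mk]
    have := norm_mk_sq_le I x _ hb'
    rw [add_sub_cancel] at this
    exact this.trans hbn.le
  star_smul r x := by
    obtain ⟨x, rfl⟩ := Ideal.Quotient.mk_surjective x
    change Ideal.Quotient.mk I (star (r • x)) = Ideal.Quotient.mk I (star r • star x)
    rw [star_smul]

/-- The quotient carries its canonical order as a C⋆-algebra. -/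
instance instPartialOrder [IsClosed (I : Set B)] : PartialOrder (B ⧸ I) :=
  CStarAlgebra.spectralOrder _

instance instStarOrderedRing [IsClosed (I : Set B)] : StarOrderedRing (B ⧸ I) :=
  CStarAlgebra.spectralOrderedRing _

end CStarQuotient

/-! ## The Calkin algebra -/

section Calkin

variable (H : Type*) [NormedAddCommGroup H] [InnerProductSpace ℂ H]

/-- The ideal `K(H)` of compact operators in `B(H)`. -/
def compactOperators : Ideal (H →L[ℂ] H) where
  carrier := {T | IsCompactOperator T}
  add_mem' := fun hS hT => hS.add hT
  zero_mem' := isCompactOperator_zero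
  smul_mem' := fun S _ hT => hT.clm_comp S

instance : (compactOperators H).IsTwoSided where
  mul_mem_of_left := fun S hT => hT.comp_clm S

instance [CompleteSpace H] : IsClosed (compactOperators H : Set (H →L[ℂ] H)) :=
  isClosed_setOfPred_isCompactOperator

/-- The Calkin algebra `Q(H) = B(H) / K(H)`. -/
abbrev Calkin : Type _ := (H →L[ℂ] H) ⧸ compactOperators H

end Calkin

/-! ## Operator systems and ucp maps -/

/-- A unital C⋆-algebra is finitely generated if some finite subset is contained in no proper
closed unital ⋆-subalgebra. -/
def IsFinitelyGeneratedCStar (A : Type*) [CStarAlgebra A] : Prop :=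
  ∃ F : Finset A, (StarAlgebra.adjoin ℂ (F : Set A)).topologicalClosure = ⊤

/-- An operator subsystem of a unital C⋆-algebra: a linear subspace that contains the unit and is
closed under the involution. -/
structure OperatorSubsystem (A : Type*) [CStarAlgebra A] extends Submodule ℂ A where
  one_mem' : (1 : A) ∈ carrier
  star_mem' : ∀ {a : A}, a ∈ carrier → star a ∈ carrier

section UCP

variable {A B C : Type*} [CStarAlgebra A] [PartialOrder A] [StarOrderedRing A]
  [CStarAlgebra B] [PartialOrder B] [StarOrderedRing B]

/-- A linear map from an operator subsystem `S` of `A` to a C⋆-algebra `B` is unital completely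
positive if it preserves the unit and every entrywise amplification `M_k(S) → M_k(B)` sends
matrices that are positive in `M_k(A)` to positive matrices. -/
structure IsUCP (S : OperatorSubsystem A) (φ : S.toSubmodule →ₗ[ℂ] B) : Prop where
  map_one : φ ⟨1, S.one_mem'⟩ = 1
  map_nonneg : ∀ (k : ℕ) (M : CStarMatrix (Fin k) (Fin k) S.toSubmodule),
    0 ≤ M.map (fun s => (s : A)) → 0 ≤ M.map φ

/-- `φ : S → C` has a ucp lift along `q : B → C`. -/
def HasUCPLift (S : OperatorSubsystem A) (q : B → C) (φ : S.toSubmodule → C) : Prop :=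
  ∃ ψ : S.toSubmodule →ₗ[ℂ] B, IsUCP S ψ ∧ ∀ s, q (ψ s) = φ s

end UCP

/-- The lifting property of an operator system: every ucp map into a quotient `B / I` of a unital
C⋆-algebra by a closed two-sided ideal has a ucp lift to `B`. -/
def HasLiftingProperty {A : Type u} [CStarAlgebra A] [PartialOrder A] [StarOrderedRing A]
    (S : OperatorSubsystem A) : Prop :=
  ∀ (B : Type v) [CStarAlgebra B] [PartialOrder B] [StarOrderedRing B]
    (I : Ideal B) [I.IsTwoSided] [IsClosed (I : Set B)]
    (φ : S.toSubmodule →ₗ[ℂ] B ⧸ I), IsUCP S φ →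
      HasUCPLift S (Ideal.Quotient.mk I) φ

end

/-! All generators of `A` are hidden in one diagonal matrix. Take self-adjoint generators b_i and
put D = diag(c_i + b_i), the real shifts c_i so far apart that the diagonal entries have disjoint
spectra. Functional calculus in D gives the diagonal matrix units, the projection P with all entries
1/N links them into all matrix units, and cutting D with these recovers each b_i. Hence a closed
star subalgebra containing D and P contains every scalar matrix aI (`scalarHom_mem_of_generators`).

The system is S = span{1, D, D², P}. Suppose the restriction of σ = ρ ⊗ id to S had a ucp lift.
Since M_N(B(H)) is B(H^N), Arveson's theorem (`IsUCP.exists_extension`) extends the lift to M_N(A),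
and following it by the quotient map gives a ucp map Φ equal to σ on S. As D² lies in S and P² = P,
Φ attains equality in the Schwarz inequality at D and at P, so both lie in its multiplicative domain
(`map_star_mul_of_map_star_mul_self`) and Φ(aI) = σ(aI) for all a. A diagonal entry of the extended
lift at aI is then a ucp lift of `ρ`, which is excluded.

For the dimension, the generators are padded with three zeros: D then has three distinct scalars on
its diagonal, which makes 1, D, D² independent, and P is not diagonal.

Arveson's theorem is reduced to M. Riesz extension (`exists_positive_extension`): a completely
positive map into B(H) is encoded as a positive functional on finitely supported matrices indexed by
an algebraic basis of H. -/

theorem CStarAlgebra.exists_eq_star_mul_self {B : Type*} [CStarAlgebra B] [PartialOrder B]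
    [StarOrderedRing B] {b : B} (hb : 0 ≤ b) : ∃ y : B, b = star y * y :=
  CStarAlgebra.nonneg_iff_eq_star_mul_self.mp hb

/-! ### Positive matrices as sums of Gram matrices -/

namespace CStarMatrix

@[simp]
theorem sum_apply' {κ m n A : Type*} [AddCommMonoid A] (s : Finset κ) (f : κ → CStarMatrix m n A)
    (i : m) (j : n) : (∑ k ∈ s, f k) i j = ∑ k ∈ s, f k i j :=
  map_sum (⟨⟨fun M : CStarMatrix m n A => M i j, rfl⟩, fun _ _ => rfl⟩ : _ →+ A) f s

variable {n κ A : Type*} [Fintype n] [DecidableEq n] [Fintype κ] [CStarAlgebra A] [PartialOrder A]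
  [StarOrderedRing A]

theorem exists_gram_of_nonneg {M : CStarMatrix n n A} (hM : 0 ≤ M) :
    ∃ Y : CStarMatrix n n A, ∀ i j, M i j = ∑ k, star (Y k i) * Y k j := by
  obtain ⟨Y, rfl⟩ := CStarAlgebra.exists_eq_star_mul_self hM
  exact ⟨Y, fun i j => by simp [mul_apply, star_apply]⟩

theorem nonneg_of_eq_gram {M : CStarMatrix n n A} (y : κ → n → A)
    (h : ∀ i j, M i j = ∑ k, star (y k i) * y k j) : 0 ≤ M := by
  rcases isEmpty_or_nonempty n with hn | ⟨⟨i₀⟩⟩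
  · exact le_of_eq (ext fun i => hn.elim i)
  -- The row `y k` is placed in row `i₀` of an otherwise zero square matrix, so that each Gram term
  -- becomes `star R * R`.
  let R : κ → CStarMatrix n n A := fun k => ofMatrix fun i j => if i = i₀ then y k j else 0
  have hR : ∀ k i j, R k i j = if i = i₀ then y k j else 0 := fun k i j => rfl
  have hsum : M = ∑ k, star (R k) * R k := by
    ext i j
    rw [h, sum_apply']
    refine Finset.sum_congr rfl fun k _ => ?_
    simp [mul_apply, star_apply, hR]
  rw [hsum]
  exact Finset.sum_nonneg fun k _ => star_mul_self_nonneg _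

theorem quadratic_form_nonneg {M : CStarMatrix n n A} (hM : 0 ≤ M) (v : n → A) :
    0 ≤ ∑ i, ∑ j, star (v i) * M i j * v j := by
  obtain ⟨Y, hY⟩ := exists_gram_of_nonneg hM
  have : ∑ i, ∑ j, star (v i) * M i j * v j
      = ∑ k, star (∑ i, Y k i * v i) * ∑ j, Y k j * v j := by
    simp_rw [hY, star_sum, Finset.sum_mul_sum, Finset.mul_sum, Finset.sum_mul]
    rw [Finset.sum_comm' (t' := Finset.univ) (s' := fun _ => Finset.univ) (by simp)]
    conv_rhs => rw [Finset.sum_comm]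
    rw [Finset.sum_comm]
    refine Finset.sum_congr rfl fun i _ => ?_
    rw [Finset.sum_comm]
    simp only [star_mul, mul_assoc]
  rw [this]
  exact Finset.sum_nonneg fun k _ => star_mul_self_nonneg _

end CStarMatrix

open scoped ComplexOrder in
/-- M. Riesz extension of positive functionals, for complex vector spaces with an involution. -/
theorem exists_positive_extension {W : Type*} [AddCommGroup W] [Module ℂ W]
    (J : W →ₗ⋆[ℂ] W) (hJ : ∀ x, J (J x) = x) (P : PointedCone ℝ W) (hP : ∀ x ∈ P, J x = x)
    (V : Submodule ℂ W) (hV : ∀ x ∈ V, J x ∈ V)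
    (hord : ∀ x, J x = x → ∃ w ∈ V, w ∈ P ∧ w + x ∈ P)
    (F : W →ₗ[ℂ] ℂ) (hF : ∀ x ∈ V, x ∈ P → 0 ≤ F x) :
    ∃ G : W →ₗ[ℂ] ℂ, (∀ x ∈ V, G x = F x) ∧ ∀ x ∈ P, 0 ≤ G x := by
  have h2 : (starRingEnd ℂ) 2⁻¹ = 2⁻¹ := by rw [map_inv₀, Complex.conj_ofNat]
  have hreal : ∀ x ∈ V, J x = x → (F x).im = 0 := by
    intro x hx hJx
    obtain ⟨w, hwV, hwP, hwx⟩ := hord x hJx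
    have h1 := (Complex.nonneg_iff.mp (hF _ (V.add_mem hwV hx) hwx)).2
    have h2 := (Complex.nonneg_iff.mp (hF _ hwV hwP)).2
    rw [map_add, Complex.add_im] at h1
    linarith
  have hre : ∀ x ∈ V, (F (J x)).re = (F x).re := by
    intro x hx
    -- Reality of F at this fixed point of J says exactly that F x and F (J x) have the same real
    -- part.
    have hJ' : J (Complex.I • (x - J x)) = Complex.I • (x - J x) := by
      rw [LinearMap.map_smulₛₗ, map_sub, hJ, Complex.conj_I, neg_smul, ← smul_neg, neg_sub]
    have := hreal _ (V.smul_mem Complex.I (V.sub_mem hx (hV x hx))) hJ'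
    simp at this
    linarith
  -- Elements whose hermitian part lies in `V`. All skew elements are included, and `f₀` vanishes on
  -- them; this later forces the complexified extension to be real on `P`.
  let D : Submodule ℝ W :=
    { carrier := {x | x + J x ∈ V}
      add_mem' := fun {x y} hx hy => by
        have := V.add_mem hx hy
        simp only [Set.mem_ofPred_eq, map_add] at this ⊢
        rwa [add_add_add_comm]
      zero_mem' := by simp
      smul_mem' := fun c x hx => by
        have := V.smul_mem (c : ℂ) hx
        simp only [Set.mem_ofPred_eq] at this ⊢
        rwa [← Complex.coe_smul c x, LinearMap.map_smulₛₗ, Complex.conj_ofReal, ← smul_add] }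
  have hDmem : ∀ x, x ∈ D ↔ x + J x ∈ V := fun x => Iff.rfl
  let f₀ : W →ₗ[ℝ] ℝ :=
    { toFun := fun x => (F (x + J x)).re / 2
      map_add' := fun x y => by simp; ring
      map_smul' := fun c x => by
        rw [← Complex.coe_smul c x, LinearMap.map_smulₛₗ, Complex.conj_ofReal, ← smul_add]
        simp; ring }
  have hf₀ : ∀ x, f₀ x = (F (x + J x)).re / 2 := fun x => rfl
  have hhalf : ∀ x : W, x ∈ V → f₀ x = (F x).re := fun x hx => by
    rw [hf₀, map_add, Complex.add_re, hre x hx]; ring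
  obtain ⟨g, hg, hgP⟩ := riesz_extension P ⟨D, f₀.domRestrict D⟩ (by
      rintro ⟨x, hx⟩ hxP
      change 0 ≤ f₀ x
      have hJx := hP x hxP
      have hxV : x ∈ V := by
        have := V.smul_mem (2⁻¹ : ℂ) ((hDmem x).mp hx)
        rwa [hJx, ← two_smul ℂ x, smul_smul, inv_mul_cancel₀ two_ne_zero, one_smul] at this
      rw [hhalf x hxV]
      exact (Complex.nonneg_iff.mp (hF x hxV hxP)).1) (by
      intro y
      obtain ⟨w, hwV, hwP, hwy⟩ := hord ((2⁻¹ : ℂ) • (y + J y)) (by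
        rw [LinearMap.map_smulₛₗ, map_add, hJ, add_comm y, h2])
      -- Subtracting the skew part of y leaves w plus its hermitian part, which `hord` puts into
      -- `P`.
      refine ⟨⟨w - (2⁻¹ : ℂ) • (y - J y), ?_⟩, ?_⟩
      · rw [hDmem, map_sub, LinearMap.map_smulₛₗ, map_sub, hJ, hP w hwP]
        have : w - (2⁻¹ : ℂ) • (y - J y) + (w - (starRingEnd ℂ) 2⁻¹ • (J y - y)) = w + w := by
          rw [h2]; module
        rw [this]
        exact V.add_mem hwV hwV
      · convert hwy using 1
        module)
  have hgf : ∀ x ∈ D, g x = f₀ x := fun x hx => hg ⟨x, hx⟩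
  have hVD : ∀ x ∈ V, x ∈ D := fun x hx => V.add_mem hx (hV x hx)
  refine ⟨Module.Dual.extendRCLike g, fun x hx => ?_, fun x hx => ?_⟩
  · rw [Module.Dual.extendRCLike_apply]
    have hI := V.smul_mem Complex.I hx
    have h1 := hgf x (hVD x hx)
    have h2 := hgf _ (hVD _ hI)
    rw [hhalf x hx] at h1
    rw [hhalf _ hI] at h2
    apply Complex.ext <;> simp [h1, h2]
  · rw [Module.Dual.extendRCLike_apply]
    have hJI : Complex.I • x + J (Complex.I • x) = 0 := by
      rw [LinearMap.map_smulₛₗ, hP x hx]; simp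
    have h2 := hgf (Complex.I • x) (by rw [hDmem, hJI]; exact V.zero_mem)
    rw [hf₀, hJI] at h2
    rw [Complex.nonneg_iff]
    simp at h2 
    simp [h2, hgP x hx]

/-! ### Matrices of operators as operators on a direct sum -/

section OperatorMatrices

open ContinuousLinearMap

variable {n H : Type*} [Fintype n] [DecidableEq n] [NormedAddCommGroup H] [InnerProductSpace ℂ H]
  [CompleteSpace H]

theorem PiLp.adjoint_proj_apply (j : n) (h : H) :
    (adjoint (PiLp.proj 2 (𝕜 := ℂ) (fun _ : n => H) j)) h = WithLp.toLp 2 (Pi.single j h) := by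
  refine ext_inner_left ℂ fun x => ?_
  rw [adjoint_inner_right, PiLp.inner_apply, Finset.sum_eq_single j]
  · simp
  · intro i _ hij
    simp [hij]
  · simp

theorem PiLp.sum_adjoint_proj_comp_proj :
    ∑ i, adjoint (PiLp.proj 2 (𝕜 := ℂ) (fun _ : n => H) i) ∘L PiLp.proj 2 (fun _ : n => H) i
      = 1 := by
  ext x k
  simp [sum_apply, PiLp.adjoint_proj_apply, Finset.sum_apply, Pi.single_apply]

namespace CStarMatrix

/-- The operator on `H ⊕ ⋯ ⊕ H` given by a matrix of operators on `H`. -/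
noncomputable def toOperator (M : CStarMatrix n n (H →L[ℂ] H)) :
    PiLp 2 (fun _ : n => H) →L[ℂ] PiLp 2 (fun _ : n => H) :=
  ∑ i, ∑ j, adjoint (PiLp.proj 2 (fun _ : n => H) i) ∘L M i j ∘L PiLp.proj 2 (fun _ : n => H) j

theorem toOperator_apply (M : CStarMatrix n n (H →L[ℂ] H)) (x : PiLp 2 (fun _ : n => H)) (i : n) :
    toOperator M x i = ∑ j, M i j (x j) := by
  simp only [toOperator, sum_apply, WithLp.ofLp_sum, Finset.sum_apply,
    ContinuousLinearMap.comp_apply, PiLp.adjoint_proj_apply, PiLp.proj_apply]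
  rw [Finset.sum_eq_single i]
  · simp
  · intro k _ hk
    simp [hk.symm]
  · simp

theorem toOperator_adjoint_proj (M : CStarMatrix n n (H →L[ℂ] H)) (k l : n) (h : H) :
    toOperator M (adjoint (PiLp.proj 2 (𝕜 := ℂ) (fun _ : n => H) l) h) k = M k l h := by
  rw [toOperator_apply, PiLp.adjoint_proj_apply, Finset.sum_eq_single l]
  · simp
  · intro j _ hj
    simp [hj]
  · simp

theorem toOperator_conj_proj
    (T : PiLp 2 (fun _ : n => H) →L[ℂ] PiLp 2 (fun _ : n => H)) :
    toOperator (ofMatrix fun i j => PiLp.proj 2 (fun _ : n => H) i ∘L T ∘L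
      adjoint (PiLp.proj 2 (fun _ : n => H) j)) = T := by
  refine ContinuousLinearMap.ext fun x => PiLp.ext fun i => ?_
  have hx : ∑ j, adjoint (PiLp.proj 2 (𝕜 := ℂ) (fun _ : n => H) j) (x j) = x := by
    have := congrArg (fun S => S x) (PiLp.sum_adjoint_proj_comp_proj (n := n) (H := H))
    rwa [sum_apply] at this
  rw [toOperator_apply]
  conv_rhs => rw [← hx, map_sum, WithLp.ofLp_sum, Finset.sum_apply]
  rfl

theorem toOperator_mul (M N : CStarMatrix n n (H →L[ℂ] H)) :
    toOperator (M * N) = toOperator M * toOperator N := by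
  refine ContinuousLinearMap.ext fun x => PiLp.ext fun i => ?_
  rw [mul_apply_eq_comp, toOperator_apply, toOperator_apply]
  simp only [toOperator_apply, CStarMatrix.mul_apply, sum_apply, mul_apply_eq_comp,
    map_sum]
  exact Finset.sum_comm

theorem inner_toOperator (M : CStarMatrix n n (H →L[ℂ] H)) (x y : PiLp 2 (fun _ : n => H)) :
    inner ℂ x (toOperator M y) = ∑ i, ∑ j, inner ℂ (x i) (M i j (y j)) := by
  simp [PiLp.inner_apply, toOperator_apply, inner_sum]

variable (n H) in
/-- Matrices of operators on `H` are the operators on `H ⊕ ⋯ ⊕ H`. -/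
noncomputable def operatorEquiv :
    CStarMatrix n n (H →L[ℂ] H) ≃⋆ₐ[ℂ]
      (PiLp 2 (fun _ : n => H) →L[ℂ] PiLp 2 (fun _ : n => H)) where
  toFun := toOperator
  invFun T := ofMatrix fun i j =>
    PiLp.proj 2 (fun _ : n => H) i ∘L T ∘L adjoint (PiLp.proj 2 (fun _ : n => H) j)
  left_inv M := by
    ext1 k l
    exact ContinuousLinearMap.ext fun h => toOperator_adjoint_proj M k l h
  right_inv := toOperator_conj_proj
  map_mul' := toOperator_mul
  map_add' M N := by
    refine ContinuousLinearMap.ext fun x => PiLp.ext fun i => ?_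
    simp [toOperator_apply, Finset.sum_add_distrib]
  map_star' M := by
    ext1 x
    refine ext_inner_left ℂ fun y => ?_
    rw [ContinuousLinearMap.star_eq_adjoint, adjoint_inner_right, inner_toOperator,
      ← inner_conj_symm, inner_toOperator, map_sum, Finset.sum_comm]
    simp_rw [map_sum, inner_conj_symm]
    simp [star_apply, ContinuousLinearMap.star_eq_adjoint, adjoint_inner_right]
  map_smul' c M := by
    refine ContinuousLinearMap.ext fun x => PiLp.ext fun i => ?_
    simp [toOperator_apply, Finset.smul_sum]

@[simp]
theorem operatorEquiv_apply (M : CStarMatrix n n (H →L[ℂ] H)) :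
    operatorEquiv n H M = toOperator M := rfl

open scoped ComplexOrder in
theorem nonneg_iff_forall_inner {M : CStarMatrix n n (H →L[ℂ] H)} :
    0 ≤ M ↔ ∀ x : n → H, 0 ≤ ∑ i, ∑ j, inner ℂ (x i) (M i j (x j)) := by
  constructor
  · intro hM x
    have h := (ContinuousLinearMap.nonneg_iff_isPositive _).mp
      (map_nonneg (operatorEquiv n H) hM)
    have := h.inner_nonneg_right (WithLp.toLp 2 x)
    rwa [operatorEquiv_apply, inner_toOperator] at this
  · intro h
    have hT : 0 ≤ toOperator M := by
      rw [ContinuousLinearMap.nonneg_iff_isPositive, ContinuousLinearMap.isPositive_iff_complex]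
      intro x
      have h1 := h (WithLp.ofLp x)
      rw [← inner_toOperator (y := x), ← inner_conj_symm, Complex.nonneg_iff, Complex.conj_re,
        Complex.conj_im] at h1
      exact ⟨Complex.ext (by simp) (by simpa [eq_comm] using h1.2), h1.1⟩
    have := map_nonneg (operatorEquiv n H).symm hT
    rwa [← operatorEquiv_apply, StarAlgEquiv.symm_apply_apply] at this

end CStarMatrix
end OperatorMatrices

/-! ### Basic completely positive maps -/

namespace CompletelyPositiveMap

variable {A B C : Type*} [CStarAlgebra A] [PartialOrder A] [StarOrderedRing A]
  [CStarAlgebra B] [PartialOrder B] [StarOrderedRing B]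
  [CStarAlgebra C] [PartialOrder C] [StarOrderedRing C]

/-- The composition of completely positive maps. -/
noncomputable def comp (g : B →CP C) (f : A →CP B) : A →CP C where
  toLinearMap := g.toLinearMap ∘ₗ f.toLinearMap
  map_cstarMatrix_nonneg' k M hM :=
    g.map_cstarMatrix_nonneg' k _ (f.map_cstarMatrix_nonneg' k M hM)

@[simp]
theorem comp_apply (g : B →CP C) (f : A →CP B) (a : A) : g.comp f a = g (f a) := rfl

/-- A unital star homomorphism as a completely positive map. -/
noncomputable def ofStarAlgHom (f : A →⋆ₐ[ℂ] B) : A →CP B where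
  toLinearMap := (f : A →ₐ[ℂ] B).toLinearMap
  map_cstarMatrix_nonneg' k M hM := by
    obtain ⟨Y, hY⟩ := CStarMatrix.exists_gram_of_nonneg hM
    refine CStarMatrix.nonneg_of_eq_gram (fun k j => f (Y k j)) fun i j => ?_
    simp [hY, map_sum, map_star]

@[simp]
theorem ofStarAlgHom_apply (f : A →⋆ₐ[ℂ] B) (a : A) : ofStarAlgHom f a = f a := rfl

/-- A diagonal matrix entry is completely positive. -/
noncomputable def entry {n : Type*} [Fintype n] [DecidableEq n] (i₀ : n) :
    CStarMatrix n n A →CP A where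
  toFun M := M i₀ i₀
  map_add' _ _ := rfl
  map_smul' _ _ := rfl
  map_cstarMatrix_nonneg' k M hM := by
    obtain ⟨Y, hY⟩ := CStarMatrix.exists_gram_of_nonneg hM
    refine CStarMatrix.nonneg_of_eq_gram (κ := Fin k × n) (fun p j => Y p.1 j p.2 i₀) fun i j => ?_
    change M i j i₀ i₀ = _
    simp [hY, CStarMatrix.mul_apply, CStarMatrix.star_apply, Fintype.sum_prod_type]

@[simp]
theorem entry_apply {n : Type*} [Fintype n] [DecidableEq n] (i₀ : n) (M : CStarMatrix n n A) :
    entry i₀ M = M i₀ i₀ := rfl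

theorem continuous_of_cp (f : A →CP B) : Continuous f := by
  obtain ⟨C, hC⟩ := PositiveLinearMap.exists_norm_apply_le
    (PositiveLinearMap.ofClass f : A →ₚ[ℂ] B)
  exact AddMonoidHomClass.continuous_of_bound f C hC

theorem map_star' (f : A →CP B) (a : A) : f (star a) = star (f a) := map_star f a

end CompletelyPositiveMap

/-! ### Arveson's extension theorem -/

namespace ArvesonExtension

variable {ι A : Type*} [CStarAlgebra A]

/-- The conjugate transpose of a finitely supported matrix. -/
noncomputable def adj : ((ι × ι) →₀ A) →ₗ⋆[ℂ] ((ι × ι) →₀ A) where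
  toFun x := (x.mapRange star (star_zero A)).equivMapDomain (Equiv.prodComm ι ι)
  map_add' x y := by ext p; simp [Finsupp.equivMapDomain_apply]
  map_smul' c x := by ext p; simp [Finsupp.equivMapDomain_apply]

theorem adj_apply (x : (ι × ι) →₀ A) (i j : ι) : adj x (i, j) = star (x (j, i)) := by
  simp [adj, Finsupp.equivMapDomain_apply]

/-- The finitely supported matrix with entries `star (y i) * y j`. -/
noncomputable def gram (y : ι →₀ A) : (ι × ι) →₀ A :=
  Finsupp.onFinset (y.support ×ˢ y.support) (fun p => star (y p.1) * y p.2) fun p hp => by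
    simp only [Finset.mem_product, Finsupp.mem_support_iff]
    constructor <;> rintro h <;> simp [h] at hp

@[simp]
theorem gram_apply (y : ι →₀ A) (p : ι × ι) : gram y p = star (y p.1) * y p.2 := rfl

theorem adj_gram (y : ι →₀ A) : adj (gram y) = gram y := by
  ext ⟨i, j⟩
  simp [adj_apply]

variable (ι A) in
/-- The cone of positive finitely supported matrices. -/
def posCone : PointedCone ℝ ((ι × ι) →₀ A) where
  carrier := {x | ∃ (m : ℕ) (y : Fin m → ι →₀ A), x = ∑ l, gram (y l)}
  add_mem' := by
    rintro _ _ ⟨m, y, rfl⟩ ⟨m', y', rfl⟩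
    exact ⟨m + m', Fin.append y y', by simp [Fin.sum_univ_add]⟩
  zero_mem' := ⟨0, Fin.elim0, by simp⟩
  smul_mem' := by
    rintro ⟨c, hc⟩ _ ⟨m, y, rfl⟩
    refine ⟨m, fun l => (Real.sqrt c : ℂ) • y l, ?_⟩
    rw [Finset.smul_sum]
    refine Finset.sum_congr rfl fun l _ => ?_
    ext p
    have : (Real.sqrt c : ℂ) * (Real.sqrt c : ℂ) = c := by
      rw [← Complex.ofReal_mul, Real.mul_self_sqrt hc]
    change c • (star (y l p.1) * y l p.2) = _
    rw [← Complex.coe_smul c, ← this]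
    simp only [Finsupp.smul_apply, gram_apply, star_smul, smul_mul_smul_comm, RCLike.star_def,
      Complex.conj_ofReal]

theorem gram_mem_posCone (y : ι →₀ A) : gram y ∈ posCone ι A := ⟨1, fun _ => y, by simp⟩

theorem adj_eq_of_mem_posCone {x : (ι × ι) →₀ A} (hx : x ∈ posCone ι A) : adj x = x := by
  obtain ⟨m, y, rfl⟩ := hx
  simp [map_sum, adj_gram]

/-- The finitely supported matrices with entries in a subspace. -/
def entriesIn (S : Submodule ℂ A) : Submodule ℂ ((ι × ι) →₀ A) where
  carrier := {x | ∀ p, x p ∈ S}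
  add_mem' hx hy p := S.add_mem (hx p) (hy p)
  zero_mem' _ := S.zero_mem
  smul_mem' c _ hx p := S.smul_mem c (hx p)

/-- For a single entry a at (i, j), choose d with d*d = ‖a‖² − a*a. Then e_ii + ‖a‖² e_jj + (a e_ij
+ its adjoint) is the Gram matrix of e_i + a e_j plus that of d e_j, and the first two terms have
scalar entries. This is the order hypothesis needed for Riesz extension. -/
theorem exists_dominating [PartialOrder A] [StarOrderedRing A] (S : OperatorSubsystem A)
    (x : (ι × ι) →₀ A) :
    ∃ w ∈ entriesIn (ι := ι) S.toSubmodule, w ∈ posCone ι A ∧ w + (x + adj x) ∈ posCone ι A := by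
  classical
  induction x using Finsupp.induction_linear with
  | zero => exact ⟨0, zero_mem _, zero_mem _, by simp⟩
  | add x y hx hy =>
    obtain ⟨w, hw, hwP, hwx⟩ := hx
    obtain ⟨w', hw', hwP', hwx'⟩ := hy
    refine ⟨w + w', add_mem hw hw', add_mem hwP hwP', ?_⟩
    convert add_mem hwx hwx' using 1
    rw [map_add]
    abel
  | single p a =>
    obtain ⟨i, j⟩ := p
    have hscalar : ∀ (k : ι) (c : ℂ),
        gram (Finsupp.single k (c • 1 : A)) ∈ entriesIn (ι := ι) S.toSubmodule := by
      rintro k c ⟨p, q⟩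
      simp only [gram_apply, Finsupp.single_apply]
      split_ifs
      · simpa using S.smul_mem _ (S.smul_mem _ S.one_mem')
      all_goals simp
    obtain ⟨d, hd⟩ := CStarAlgebra.exists_eq_star_mul_self
      (sub_nonneg.mpr (CStarAlgebra.star_mul_le_algebraMap_norm_sq (a := a)))
    refine ⟨gram (Finsupp.single i ((1 : ℂ) • 1 : A)) +
      gram (Finsupp.single j ((‖a‖ : ℂ) • 1 : A)), add_mem (hscalar _ _) (hscalar _ _),
      add_mem (gram_mem_posCone _) (gram_mem_posCone _), ?_⟩
    have : gram (Finsupp.single i ((1 : ℂ) • 1 : A)) + gram (Finsupp.single j ((‖a‖ : ℂ) • 1 : A))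
        + (Finsupp.single (i, j) a + adj (Finsupp.single (i, j) a))
        = gram (Finsupp.single i 1 + Finsupp.single j a) + gram (Finsupp.single j d) := by
      ext ⟨p, q⟩
      have hd' : ((‖a‖ : ℂ) * (‖a‖ : ℂ)) • (1 : A) = star a * a + star d * d := by
        rw [← hd]
        simp [Algebra.algebraMap_eq_smul_one, sq, ← Complex.ofReal_mul]
      -- Kronecker deltas as scalars turn the entrywise identity into a module identity, with no
      -- case split on i = j.
      let δ : ι → ι → ℂ := fun k l => if k = l then 1 else 0
      have hδ : ∀ k l, star (δ k l) = δ k l := fun k l => by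
        by_cases h : k = l <;> simp [δ, h]
      have h1 : ∀ k l (x : A), Finsupp.single k x l = δ k l • x := fun k l x => by
        by_cases h : k = l <;> simp [δ, h]
      have h2 : ∀ k l, Finsupp.single (i, j) a (k, l) = (δ i k * δ j l) • a := fun k l => by
        by_cases h : i = k <;> by_cases h' : j = l <;> simp [δ, h, h']
      have h3 : ∀ k l, star (δ j k • ((‖a‖ : ℂ) • (1 : A))) * (δ j l • ((‖a‖ : ℂ) • (1 : A)))
          = (δ j k * δ j l) • (star a * a + star d * d) := fun k l => by
        rw [← hd', smul_smul, smul_smul, star_smul, star_mul, hδ, star_one, smul_mul_smul_comm,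
          smul_smul, one_mul, RCLike.star_def, Complex.conj_ofReal]
        congr 1
        ring
      simp only [Finsupp.add_apply, gram_apply, adj_apply, h1, h2, h3, star_add]
      simp only [star_smul, star_mul, hδ, star_one, mul_add, add_mul, smul_mul_smul_comm, one_mul,
        mul_one, one_smul]
      module
    rw [this]
    exact add_mem (gram_mem_posCone _) (gram_mem_posCone _)

variable {H : Type*} [NormedAddCommGroup H] [InnerProductSpace ℂ H]

/-- The rank one matrix of `h`, `k` in a basis, with coefficient `a`. -/
noncomputable def rankOne (b : Module.Basis ι ℂ H) (a : A) (h k : H) : (ι × ι) →₀ A :=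
  Finsupp.onFinset ((b.repr h).support ×ˢ (b.repr k).support)
    (fun p => (star (b.repr h p.1) * b.repr k p.2) • a) fun p hp => by
      simp only [Finset.mem_product, Finsupp.mem_support_iff]
      constructor <;> rintro h <;> simp [h] at hp

@[simp]
theorem rankOne_apply (b : Module.Basis ι ℂ H) (a : A) (h k : H) (p : ι × ι) :
    rankOne b a h k p = (star (b.repr h p.1) * b.repr k p.2) • a := rfl

theorem rankOne_basis (b : Module.Basis ι ℂ H) (a : A) (i j : ι) :
    rankOne b a (b i) (b j) = Finsupp.single (i, j) a := by
  classical
  ext ⟨p, q⟩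
  simp only [rankOne_apply, Module.Basis.repr_self, Finsupp.single_apply, Prod.mk.injEq]
  by_cases h1 : i = p <;> by_cases h2 : j = q <;> simp [h1, h2]

/-- The sesquilinear form attached to a functional on finitely supported matrices. -/
noncomputable def form (b : Module.Basis ι ℂ H) (G : ((ι × ι) →₀ A) →ₗ[ℂ] ℂ) (a : A) :
    H →ₗ⋆[ℂ] H →ₗ[ℂ] ℂ :=
  LinearMap.mk₂'ₛₗ (starRingEnd ℂ) (RingHom.id ℂ) (fun h k => G (rankOne b a h k))
    (fun h h' k => by rw [← map_add]; congr 1; ext p; simp [add_mul, add_smul])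
    (fun c h k => by rw [← map_smul]; congr 1; ext p; simp [smul_smul, mul_assoc])
    (fun h k k' => by rw [← map_add]; congr 1; ext p; simp [mul_add, add_smul])
    (fun c h k => by rw [← map_smul]; congr 1; ext p; simp [smul_smul, mul_left_comm])

theorem form_apply (b : Module.Basis ι ℂ H) (G : ((ι × ι) →₀ A) →ₗ[ℂ] ℂ) (a : A) (h k : H) :
    form b G a h k = G (rankOne b a h k) := rfl

theorem form_add (b : Module.Basis ι ℂ H) (G : ((ι × ι) →₀ A) →ₗ[ℂ] ℂ) (a a' : A) (h k : H) :
    form b G (a + a') h k = form b G a h k + form b G a' h k := by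
  rw [form_apply, form_apply, form_apply, ← map_add]
  congr 1
  ext p
  simp

theorem form_smul (b : Module.Basis ι ℂ H) (G : ((ι × ι) →₀ A) →ₗ[ℂ] ℂ) (c : ℂ) (a : A) (h k : H) :
    form b G (c • a) h k = c * form b G a h k := by
  rw [form_apply, form_apply, ← smul_eq_mul, ← map_smul]
  congr 1
  ext p
  simp [smul_smul, mul_comm]

theorem form_sum {κ : Type*} (b : Module.Basis ι ℂ H) (G : ((ι × ι) →₀ A) →ₗ[ℂ] ℂ) (s : Finset κ)
    (a : κ → A) (h k : H) :
    form b G (∑ l ∈ s, a l) h k = ∑ l ∈ s, form b G (a l) h k :=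
  map_sum (⟨⟨fun a => form b G a h k, by simpa using form_smul b G 0 0 h k⟩,
    fun a a' => form_add b G a a' h k⟩ : A →+ ℂ) a s

-- The double sum is G at a single Gram matrix, that of the vector ∑ h_p ⊗ y_p written in the basis.
open scoped ComplexOrder in
theorem form_gram_nonneg {κ : Type*} [Fintype κ] (b : Module.Basis ι ℂ H)
    {G : ((ι × ι) →₀ A) →ₗ[ℂ] ℂ} (hG : ∀ x ∈ posCone ι A, 0 ≤ G x) (h : κ → H) (y : κ → A) :
    0 ≤ ∑ p, ∑ q, form b G (star (y p) * y q) (h p) (h q) := by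
  have : ∑ p, ∑ q, form b G (star (y p) * y q) (h p) (h q)
      = G (gram (∑ p, (b.repr (h p)).mapRange (· • y p) (zero_smul ℂ _))) := by
    simp_rw [form_apply, ← map_sum]
    congr 1
    ext p
    simp [Finsupp.finsetSum_apply, Finset.sum_mul_sum, star_sum, smul_smul, mul_comm]
  rw [this]
  exact hG _ (gram_mem_posCone _)

-- A Cauchy–Schwarz argument with a non-sharp constant: any bound suffices to represent the form by
-- a bounded operator. The defect d with d*d = ‖a‖² − a*a replaces the unknown value at a*a by
-- ‖a‖²‖k‖².
open scoped ComplexOrder in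
theorem norm_form_le [PartialOrder A] [StarOrderedRing A] (b : Module.Basis ι ℂ H)
    {G : ((ι × ι) →₀ A) →ₗ[ℂ] ℂ} (hG : ∀ x ∈ posCone ι A, 0 ≤ G x)
    (h1 : ∀ h k, form b G 1 h k = inner ℂ h k) (a : A) (h k : H) :
    ‖form b G a h k‖ ≤ (1 + ‖a‖ ^ 2) * ‖h‖ * ‖k‖ := by
  obtain ⟨d, hd⟩ := CStarAlgebra.exists_eq_star_mul_self
    (sub_nonneg.mpr (CStarAlgebra.star_mul_le_algebraMap_norm_sq (a := a)))
  have key : ∀ h k : H, ‖form b G a h k‖ ≤ ‖h‖ ^ 2 + ‖a‖ ^ 2 * ‖k‖ ^ 2 := by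
    intro h k
    have hpos : ∀ c : ℂ, star c * c = 1 → 0 ≤ (‖h‖ : ℂ) ^ 2 + (‖a‖ : ℂ) ^ 2 * (‖k‖ : ℂ) ^ 2 +
        (star c * form b G a h k + c * form b G (star a) k h) := by
      intro c hc
      have e1 := form_gram_nonneg b hG ![c • h, k] ![1, a]
      have e2 := form_gram_nonneg b hG ![k] ![d]
      have e3 : form b G (star a * a) k k + form b G (star d * d) k k
          = (‖a‖ : ℂ) ^ 2 * (‖k‖ : ℂ) ^ 2 := by
        rw [← form_add, ← hd, add_sub_cancel, Algebra.algebraMap_eq_smul_one,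
          ← Complex.coe_smul, form_smul, h1, inner_self_eq_norm_sq_to_K]
        simp
      have e4 := add_nonneg e1 e2
      simp [h1, inner_self_eq_norm_sq_to_K] at e4
      rw [← mul_assoc, mul_comm c, show starRingEnd ℂ c * c = 1 from hc, one_mul] at e4
      convert e4 using 1
      rw [← e3, RCLike.star_def]
      ring
    -- The vanishing imaginary parts show that the two cross terms are conjugate; the signs ±1 and
    -- ±i then bound the real and imaginary parts of the form.
    have p1 := Complex.nonneg_iff.mp (hpos 1 (by simp))
    have p2 := Complex.nonneg_iff.mp (hpos (-1) (by simp))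
    have p3 := Complex.nonneg_iff.mp (hpos Complex.I (by simp))
    have p4 := Complex.nonneg_iff.mp (hpos (-Complex.I) (by simp))
    refine (Complex.norm_le_abs_re_add_abs_im _).trans ?_
    simp [← Complex.ofReal_pow, ← Complex.ofReal_mul] at p1 p2 p3 p4
    have q1 : |(form b G a h k).re| ≤ (‖h‖ ^ 2 + ‖a‖ ^ 2 * ‖k‖ ^ 2) / 2 := by
      rw [abs_le]; constructor <;> linarith
    have q2 : |(form b G a h k).im| ≤ (‖h‖ ^ 2 + ‖a‖ ^ 2 * ‖k‖ ^ 2) / 2 := by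
      rw [abs_le]; constructor <;> linarith
    linarith
  rcases eq_or_ne h 0 with rfl | hh
  · simp
  rcases eq_or_ne k 0 with rfl | hk
  · simp
  have hh' : ‖h‖ ≠ 0 := norm_ne_zero_iff.mpr hh
  have hk' : ‖k‖ ≠ 0 := norm_ne_zero_iff.mpr hk
  -- At unit vectors the additive bound reads 1 + ‖a‖²; sesquilinearity restores the norms.
  have := key ((‖h‖ : ℂ)⁻¹ • h) ((‖k‖ : ℂ)⁻¹ • k)
  simp [norm_smul, hh', hk'] at this
  rw [← mul_assoc, ← mul_inv, inv_mul_le_iff₀ (by positivity)] at this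
  linarith

variable [CompleteSpace H]

theorem exists_operator_of_bound (B : H →ₗ⋆[ℂ] H →ₗ[ℂ] ℂ) (C : ℝ)
    (hB : ∀ h k, ‖B h k‖ ≤ C * ‖h‖ * ‖k‖) : ∃ T : H →L[ℂ] H, ∀ h k, inner ℂ h (T k) = B h k := by
  refine ⟨ContinuousLinearMap.adjoint
    (InnerProductSpace.continuousLinearMapOfBilin (LinearMap.mkContinuous₂ B C hB)), fun h k => ?_⟩
  rw [ContinuousLinearMap.adjoint_inner_right, InnerProductSpace.continuousLinearMapOfBilin_apply]
  rfl

-- The functional F sends a matrix (a_ij) to ∑ ⟨b_i, ψ(a_ij) b_j⟩, and complete positivity on S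
-- makes F nonnegative on positive matrices with entries in S. Only the values of `ψ` on S matter: F
-- is replaced by an extension that is positive on the whole cone.
open scoped ComplexOrder in
theorem exists_form_extension [PartialOrder A] [StarOrderedRing A] (S : OperatorSubsystem A)
    (b : Module.Basis ι ℂ H) (ψ : A →ₗ[ℂ] (H →L[ℂ] H))
    (hψ : IsUCP S (ψ ∘ₗ S.toSubmodule.subtype)) :
    ∃ G : ((ι × ι) →₀ A) →ₗ[ℂ] ℂ, (∀ x ∈ posCone ι A, 0 ≤ G x) ∧
      ∀ s ∈ S.toSubmodule, ∀ h k, form b G s h k = inner ℂ h (ψ s k) := by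
  classical
  let F : ((ι × ι) →₀ A) →ₗ[ℂ] ℂ := Finsupp.lsum ℂ fun p =>
    (innerSL ℂ (b p.1)).toLinearMap ∘ₗ (ContinuousLinearMap.apply ℂ H (b p.2)).toLinearMap ∘ₗ ψ
  have hFsingle : ∀ i j a, F (Finsupp.single (i, j) a) = inner ℂ (b i) (ψ a (b j)) := by
    intro i j a
    simp [F]
  have hFsum : ∀ (s : Finset ι) (x : (ι × ι) →₀ A), x.support ⊆ s ×ˢ s →
      F x = ∑ i ∈ s, ∑ j ∈ s, inner ℂ (b i) (ψ (x (i, j)) (b j)) := by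
    intro s x hx
    rw [← Finset.sum_product', Finsupp.lsum_apply, Finsupp.sum_of_support_subset _ hx]
    · rfl
    · simp
  obtain ⟨G, hGS, hGP⟩ := exists_positive_extension (adj (ι := ι) (A := A))
    (fun x => by ext ⟨i, j⟩; simp [adj_apply]) (posCone ι A) (fun x => adj_eq_of_mem_posCone)
    (entriesIn S.toSubmodule) (fun x hx p => by
      rw [adj_apply]; exact S.star_mem' (hx _))
    (fun x hx => by
      obtain ⟨w, hw, hwP, hwx⟩ := exists_dominating S ((2⁻¹ : ℂ) • x)
      refine ⟨w, hw, hwP, ?_⟩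
      convert hwx using 2
      have h2 : (starRingEnd ℂ) 2⁻¹ = 2⁻¹ := by rw [map_inv₀, Complex.conj_ofNat]
      rw [LinearMap.map_smulₛₗ, hx, h2]
      module)
    F (by
      rintro x hxS ⟨m, y, rfl⟩
      -- A common finite support turns x into a genuine square matrix over S, to which complete
      -- positivity applies.
      let s : Finset ι := Finset.univ.biUnion fun l => (y l).support
      have hs : ∀ l, (y l).support ⊆ s := fun l =>
        Finset.subset_biUnion_of_mem (fun l => (y l).support) (Finset.mem_univ l)
      have hsupp : (∑ l, gram (y l)).support ⊆ s ×ˢ s := by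
        refine (Finsupp.support_finsetSum).trans (Finset.biUnion_subset.mpr fun l _ => ?_)
        exact (Finsupp.support_onFinset_subset).trans (Finset.product_subset_product (hs l) (hs l))
      let e := s.equivFin.symm
      let M : CStarMatrix (Fin s.card) (Fin s.card) S.toSubmodule :=
        CStarMatrix.ofMatrix fun p q => ⟨(∑ l, gram (y l)) ((e p : ι), (e q : ι)), hxS _⟩
      have hM := hψ.map_nonneg _ M (CStarMatrix.nonneg_of_eq_gram (fun l p => y l (e p))
        fun p q => by
          change (∑ l, gram (y l)) ((e p : ι), (e q : ι)) = _
          simp)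
      have := CStarMatrix.nonneg_iff_forall_inner.mp hM fun p => b (e p)
      rw [hFsum s _ hsupp, ← Finset.sum_coe_sort, ← e.sum_comp]
      convert this using 2 with p
      rw [← Finset.sum_coe_sort, ← e.sum_comp]
      rfl)
  refine ⟨G, hGP, fun s hs => ?_⟩
  let B' : H →ₗ⋆[ℂ] H →ₗ[ℂ] ℂ := LinearMap.mk₂'ₛₗ (starRingEnd ℂ) (RingHom.id ℂ)
    (fun h k => inner ℂ h (ψ s k)) (by simp) (by simp [mul_comm])
    (by simp) (by simp)
  have : form b G s = B' := by
    refine b.ext fun i => b.ext fun j => ?_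
    rw [form_apply, rankOne_basis, hGS, hFsingle]
    · rfl
    · intro p
      rw [Finsupp.single_apply]
      split_ifs
      exacts [hs, zero_mem _]
  intro h k
  rw [this]
  rfl

end ArvesonExtension

open ArvesonExtension in
open scoped ComplexOrder in
/-- **Arveson's extension theorem**: a ucp map on an operator subsystem with values in `B(H)`
extends to a completely positive map on the whole C⋆-algebra. -/
theorem IsUCP.exists_extension {A H : Type*} [CStarAlgebra A] [PartialOrder A] [StarOrderedRing A]
    [NormedAddCommGroup H] [InnerProductSpace ℂ H] [CompleteSpace H] {S : OperatorSubsystem A}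
    {φ : S.toSubmodule →ₗ[ℂ] (H →L[ℂ] H)} (hφ : IsUCP S φ) :
    ∃ Φ : A →CP (H →L[ℂ] H), ∀ s : S.toSubmodule, Φ s = φ s := by
  -- A merely linear extension, with no positivity off S; it only serves to define the functional on
  -- all matrices.
  obtain ⟨ψ, rfl⟩ := LinearMap.exists_extend φ
  let b := Module.Basis.ofVectorSpace ℂ H
  obtain ⟨G, hG, hGS⟩ := exists_form_extension S b ψ hφ
  have h1 : ∀ h k, form b G 1 h k = inner ℂ h k := fun h k => by
    have := hφ.map_one
    simp only [LinearMap.comp_apply, Submodule.subtype_apply] at this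
    rw [hGS 1 S.one_mem', this]
    rfl
  choose T hT using fun a => exists_operator_of_bound (form b G a) _ (norm_form_le b hG h1 a)
  refine ⟨⟨⟨⟨T, fun a a' => ?_⟩, fun c a => ?_⟩, fun k M hM => ?_⟩, fun s => ?_⟩
  · refine ContinuousLinearMap.ext fun k => ext_inner_left ℂ fun h => ?_
    simp [hT, inner_add_right, form_add]
  · refine ContinuousLinearMap.ext fun k => ext_inner_left ℂ fun h => ?_
    simp [hT, inner_smul_right, form_smul]
  · rw [CStarMatrix.nonneg_iff_forall_inner]
    intro x
    obtain ⟨Y, hY⟩ := CStarMatrix.exists_gram_of_nonneg hM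
    have : ∑ i, ∑ j, inner ℂ (x i) (T (M i j) (x j))
        = ∑ l, ∑ i, ∑ j, form b G (star (Y l i) * Y l j) (x i) (x j) := by
      simp_rw [hT, hY, form_sum]
      rw [Finset.sum_comm_cycle]
    refine this.symm ▸ Finset.sum_nonneg fun l _ => form_gram_nonneg b hG x (Y l)
  · refine ContinuousLinearMap.ext fun k => ext_inner_left ℂ fun h => ?_
    exact (hT _ _ _).trans (hGS _ s.2 _ _)

/-! ### Multiplicative domains -/

namespace CompletelyPositiveMap

variable {A B : Type*} [CStarAlgebra A] [PartialOrder A] [StarOrderedRing A]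
  [CStarAlgebra B] [PartialOrder B] [StarOrderedRing B]

/-- An element where a unital completely positive map attains equality in the Schwarz inequality
lies in its multiplicative domain. -/
theorem map_star_mul_of_map_star_mul_self (Φ : A →CP B) (h1 : Φ 1 = 1) {x : A}
    (hx : Φ (star x * x) = star (Φ x) * Φ x) (y : A) :
    Φ (star x * y) = star (Φ x) * Φ y := by
  set z := Φ (star x * y) - star (Φ x) * Φ y with hz
  set w := Φ (star y * y) - star (Φ y) * Φ y with hw
  have hyx : Φ (star y * x) = star z + star (Φ y) * Φ x := by
    rw [hz, star_sub, star_mul, star_star, ← map_star' Φ, star_mul, star_star]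
    abel
  -- The image under Φ of the Gram matrix of (1, x, y) is positive. The first test coordinate takes
  -- the Schur complement of its corner Φ 1 = 1, leaving the block with rows (0, z) and (z*, w); the
  -- zero is the assumed Schwarz equality. Testing at (−tz, 1) gives w − 2t z*z.
  have hle : ∀ t : ℝ, (2 * t) • (star z * z) ≤ w := by
    intro t
    let M : CStarMatrix (Fin 3) (Fin 3) A :=
      CStarMatrix.ofMatrix fun i j => star (![1, x, y] i) * ![1, x, y] j
    have hM : 0 ≤ M :=
      CStarMatrix.nonneg_of_eq_gram (κ := Unit) (fun _ => ![1, x, y]) fun i j => by simp; rfl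
    have := CStarMatrix.quadratic_form_nonneg (Φ.map_cstarMatrix_nonneg M hM)
      ![Φ x * (t • z) - Φ y, -(t • z), 1]
    have hMap : ∀ i j, M.map Φ i j = Φ (star (![1, x, y] i) * ![1, x, y] j) := fun i j => rfl
    rw [← sub_nonneg]
    convert this using 1
    simp only [hMap, Fin.sum_univ_three, Matrix.cons_val_zero, Matrix.cons_val_one,
      Matrix.cons_val_two, Matrix.head_cons, Matrix.tail_cons, star_one, one_mul, mul_one, h1, hx,
      hyx, map_star' Φ]
    rw [show Φ (star x * y) = z + star (Φ x) * Φ y by rw [hz]; abel,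
      show Φ (star y * y) = w + star (Φ y) * Φ y by rw [hw]; abel]
    simp only [star_sub, star_neg, star_mul, star_smul, star_trivial, mul_sub, sub_mul, mul_neg,
      neg_mul, smul_mul_assoc, mul_smul_comm, mul_add, add_mul, ← mul_assoc]
    module
  have hz0 : star z * z = 0 := by
    have hnn : 0 ≤ star z * z := star_mul_self_nonneg z
    by_contra hne
    have hpos : 0 < ‖star z * z‖ := norm_pos_iff.mpr hne
    have ht : 0 ≤ ‖w‖ + 1 := by positivity
    have := CStarAlgebra.norm_le_norm_of_nonneg_of_le
      -- This t would give 2(‖w‖ + 1) ≤ ‖w‖.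
      (smul_nonneg (by positivity) hnn) (hle ((‖w‖ + 1) / ‖star z * z‖))
    rw [norm_smul, Real.norm_of_nonneg (by positivity)] at this
    field_simp at this
    linarith
  exact sub_eq_zero.mp (CStarRing.star_mul_self_eq_zero_iff z |>.mp hz0)

/-- The elements on which a completely positive map behaves like a star homomorphism `σ`. -/
def agreement (σ : A →⋆ₐ[ℂ] B) (Φ : A →CP B) : StarSubalgebra ℂ A where
  carrier := {x | (∀ y, Φ (x * y) = σ x * Φ y) ∧ ∀ y, Φ (star x * y) = σ (star x) * Φ y}
  mul_mem' := by
    rintro a b ⟨ha, ha'⟩ ⟨hb, hb'⟩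
    exact ⟨fun y => by rw [mul_assoc, ha, hb, map_mul, mul_assoc],
      fun y => by rw [star_mul, mul_assoc, hb', ha', map_mul, mul_assoc]⟩
  add_mem' := by
    rintro a b ⟨ha, ha'⟩ ⟨hb, hb'⟩
    exact ⟨fun y => by rw [add_mul, map_add, ha, hb, map_add, add_mul],
      fun y => by rw [star_add, add_mul, map_add, ha', hb', map_add, add_mul]⟩
  algebraMap_mem' c := by
    have : ∀ (c : ℂ) (y : A), Φ (algebraMap ℂ A c * y) = σ (algebraMap ℂ A c) * Φ y := by
      intro c y
      rw [AlgHomClass.commutes, ← Algebra.smul_def, ← Algebra.smul_def, map_smul]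
    exact ⟨this c, fun y => by rw [← algebraMap_star_comm, this]⟩
  star_mem' := by
    rintro a ⟨ha, ha'⟩
    exact ⟨ha', by simpa using ha⟩

/-- Agreement at x and at x² is equality in the Schwarz inequality; this is why D² is put into the
operator system. -/
theorem mem_agreement_of_isSelfAdjoint {σ : A →⋆ₐ[ℂ] B} {Φ : A →CP B} (h1 : Φ 1 = 1) {x : A}
    (hx : IsSelfAdjoint x) (h : Φ x = σ x) (hsq : Φ (x * x) = σ (x * x)) : x ∈ agreement σ Φ := by
  have key : ∀ y, Φ (x * y) = σ x * Φ y := fun y => by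
    have := map_star_mul_of_map_star_mul_self Φ h1 (x := x)
      (by rw [← map_star', hx.star_eq, hsq, h, map_mul]) y
    rwa [← map_star', hx.star_eq, h] at this
  exact ⟨key, by rwa [hx.star_eq]⟩

theorem eq_of_mem_agreement {σ : A →⋆ₐ[ℂ] B} {Φ : A →CP B} (h1 : Φ 1 = 1) {x : A}
    (hx : x ∈ agreement σ Φ) : Φ x = σ x := by
  simpa [h1] using hx.1 1

theorem isClosed_agreement (σ : A →⋆ₐ[ℂ] B) (Φ : A →CP B) :
    IsClosed (agreement σ Φ : Set A) := by
  have hΦ := continuous_of_cp Φ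
  have hσ : Continuous σ := map_continuous σ
  have : (agreement σ Φ : Set A) = (⋂ y, {x | Φ (x * y) = σ x * Φ y}) ∩
      ⋂ y, {x | Φ (star x * y) = σ (star x) * Φ y} := by
    ext x
    simp only [Set.mem_inter_iff, Set.mem_iInter]
    rfl
  rw [this]
  exact (isClosed_iInter fun y => isClosed_eq (by fun_prop) (by fun_prop)).inter
    (isClosed_iInter fun y => isClosed_eq (by fun_prop) (by fun_prop))

end CompletelyPositiveMap

/-! ### Generators of matrix algebras -/

namespace CStarMatrix

section Averaging

variable (n A : Type*) [Fintype n] [CStarAlgebra A]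

/-- The rank one projection all of whose entries are equal. -/
noncomputable def averaging : CStarMatrix n n A :=
  ofMatrix fun _ _ => ((Fintype.card n : ℂ)⁻¹ • 1 : A)

variable {n A}

theorem averaging_apply (i j : n) : averaging n A i j = (Fintype.card n : ℂ)⁻¹ • 1 := rfl

theorem isSelfAdjoint_averaging : IsSelfAdjoint (averaging n A) := by
  ext i j
  simp [star_apply, averaging_apply]

theorem averaging_mul_self [Nonempty n] : averaging n A * averaging n A = averaging n A := by
  ext i j
  have : (Fintype.card n : ℂ) ≠ 0 := by simp
  simp [mul_apply, averaging_apply, smul_smul, ← Nat.cast_smul_eq_nsmul ℂ, this]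

end Averaging

variable {n : Type*} [Fintype n] [DecidableEq n]

/-- A unital star homomorphism applied entrywise. -/
def mapStarAlgHom {A B : Type*} [CStarAlgebra A] [CStarAlgebra B] (f : A →⋆ₐ[ℂ] B) :
    CStarMatrix n n A →⋆ₐ[ℂ] CStarMatrix n n B where
  toFun M := M.map f
  map_one' := by ext i j; simp [one_apply, apply_ite f]
  map_mul' M N := by ext i j; simp [mul_apply]
  map_zero' := by ext i j; simp
  map_add' M N := by ext i j; simp
  commutes' c := by
    ext i j
    simp only [map_apply, algebraMap_apply]
    split_ifs <;> simp [AlgHomClass.commutes]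
  map_star' M := by ext i j; simp [star_apply, map_star]

@[simp]
theorem mapStarAlgHom_apply {A B : Type*} [CStarAlgebra A] [CStarAlgebra B] (f : A →⋆ₐ[ℂ] B)
    (M : CStarMatrix n n A) : mapStarAlgHom f M = M.map f := rfl

theorem mapStarAlgHom_surjective {A B : Type*} [CStarAlgebra A] [CStarAlgebra B]
    {f : A →⋆ₐ[ℂ] B} (hf : Function.Surjective f) :
    Function.Surjective (mapStarAlgHom f : CStarMatrix n n A →⋆ₐ[ℂ] CStarMatrix n n B) := fun M =>
  ⟨ofMatrix fun i j => Function.surjInv hf (M i j), ext fun i j => Function.surjInv_eq hf (M i j)⟩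

variable {A : Type*} [CStarAlgebra A]

variable (n A) in
/-- The diagonal matrices. -/
def diagonalHom : (n → A) →⋆ₐ[ℂ] CStarMatrix n n A where
  toFun α := ofMatrix (Matrix.diagonal α)
  map_one' := congrArg ofMatrix Matrix.diagonal_one
  map_mul' α β := congrArg ofMatrix (Matrix.diagonal_mul_diagonal α β).symm
  map_zero' := congrArg ofMatrix Matrix.diagonal_zero
  map_add' α β := congrArg ofMatrix (Matrix.diagonal_add α β).symm
  commutes' _ := rfl
  map_star' α := congrArg ofMatrix (Matrix.diagonal_conjTranspose α).symm

theorem diagonalHom_apply (α : n → A) (i j : n) :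
    diagonalHom n A α i j = if i = j then α i else 0 := rfl

variable (n A) in
/-- The diagonal matrices with constant diagonal. -/
def scalarHom : A →⋆ₐ[ℂ] CStarMatrix n n A where
  toFun a := diagonalHom n A fun _ => a
  map_one' := map_one (diagonalHom n A)
  map_mul' _ _ := map_mul (diagonalHom n A) _ _
  map_zero' := map_zero (diagonalHom n A)
  map_add' _ _ := map_add (diagonalHom n A) _ _
  commutes' c := AlgHomClass.commutes (diagonalHom n A) c
  map_star' _ := map_star (diagonalHom n A) _

theorem scalarHom_apply (a : A) (i j : n) :
    scalarHom n A a i j = if i = j then a else 0 := rfl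

variable (A) in
/-- The matrix units. -/
def matrixUnit (i j : n) : CStarMatrix n n A := ofMatrix fun k l => if i = k ∧ j = l then 1 else 0

omit [Fintype n] in
theorem matrixUnit_apply (i j k l : n) :
    matrixUnit A i j k l = if i = k ∧ j = l then 1 else 0 := rfl

theorem diagonalHom_single_mul_averaging_mul [Nonempty n] (i j : n) :
    (Fintype.card n : ℂ) • (diagonalHom n A (Pi.single i 1) * averaging n A *
      diagonalHom n A (Pi.single j 1)) = matrixUnit A i j := by
  ext k l
  have : (Fintype.card n : ℂ) ≠ 0 := by simp
  simp only [smul_apply, mul_apply, diagonalHom_apply, averaging_apply, matrixUnit_apply,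
    Pi.single_apply, ite_mul, zero_mul, Finset.sum_ite_eq, Finset.mem_univ, if_true, mul_ite,
    mul_zero, Finset.sum_ite_eq', one_mul, mul_one]
  rcases eq_or_ne k i with rfl | hk
  · rcases eq_or_ne l j with rfl | hl
    · simp [smul_smul, this]
    · simp [hl, hl.symm]
  · simp [hk, hk.symm]

theorem sum_matrixUnit_mul_diagonalHom_mul (α : n → A) (i : n) :
    ∑ k, matrixUnit A k i * diagonalHom n A α * matrixUnit A i k = scalarHom n A (α i) := by
  ext k l
  simp [mul_apply, diagonalHom_apply, scalarHom_apply, matrixUnit_apply, ite_and, eq_comm]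

variable {c : n → ℝ} {R : ℝ} {b : n → A}

/-- The spectrum of c_j + b_j lies within R of c_j, so a continuous function can be 1 on the i-th
spectrum and 0 on the others. Functional calculus stays in the closed star subalgebra and acts
coordinatewise on the product. -/
theorem single_mem_of_separated [Nontrivial A] (hb : ∀ i, IsSelfAdjoint (b i))
    (hR : ∀ i, ‖b i‖ ≤ R)
    (hc : ∀ i j, i ≠ j → 2 * R + 1 ≤ |c i - c j|) (M : StarSubalgebra ℂ (n → A))
    (hM : IsClosed (M : Set (n → A))) (hmem : (fun i => algebraMap ℝ A (c i) + b i) ∈ M) (i : n) :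
    Pi.single i 1 ∈ M := by
  -- Equal to 1 up to distance R from c_i and 0 from distance R + 1 on; the ramp of width 1 accounts
  -- for the gap 2R + 1.
  let f : ℂ → ℂ := fun z => (max 0 (min 1 (R + 1 - ‖z - c i‖)) : ℝ)
  have hf : Continuous f := by fun_prop
  have hsa : ∀ j, IsStarNormal (algebraMap ℝ A (c j) + b j) := fun j =>
    ((IsSelfAdjoint.algebraMap A (IsSelfAdjoint.all (c j))).add (hb j)).isStarNormal
  have hspec : ∀ j, ∀ z ∈ spectrum ℂ (algebraMap ℝ A (c j) + b j), ‖z - c j‖ ≤ R := by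
    intro j z hz
    rw [IsScalarTower.algebraMap_apply ℝ ℂ A, ← sub_add_cancel z (c j : ℂ),
      Complex.coe_algebraMap, spectrum.add_mem_add_iff] at hz
    exact (spectrum.norm_le_norm_of_mem hz).trans (hR j)
  have hcfc : cfc f (fun j => algebraMap ℝ A (c j) + b j) = Pi.single i 1 := by
    rw [cfc_map_pi (S := ℂ) f _ hf.continuousOn ⟨by ext j; exact (hsa j).star_comm_self⟩ hsa]
    ext j
    by_cases hij : j = i
    · subst hij
      rw [Pi.single_eq_same, ← cfc_one ℂ (algebraMap ℝ A (c j) + b j) (ha := hsa j)]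
      refine cfc_congr fun z hz => ?_
      have := hspec j z hz
      simp only [f, Pi.one_apply]
      rw [min_eq_left (by linarith), max_eq_right zero_le_one, Complex.ofReal_one]
    · rw [Pi.single_eq_of_ne hij, ← cfc_zero ℂ (algebraMap ℝ A (c j) + b j)]
      refine cfc_congr fun z hz => ?_
      have h1 := hspec j z hz
      have h2 := hc i j (Ne.symm hij)
      have h3 := norm_sub_le_norm_sub_add_norm_sub (c i : ℂ) z (c j)
      rw [norm_sub_rev (c i : ℂ) z, ← Complex.ofReal_sub, Complex.norm_real, Real.norm_eq_abs] at h3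
      simp only [f, Pi.zero_apply]
      rw [max_eq_left ((min_le_right _ _).trans (by linarith)), Complex.ofReal_zero]
  rw [← hcfc]
  exact cfc_mem (𝕜' := ℂ) f hmem

theorem scalarHom_mem_of_generators [Nontrivial A] [PartialOrder A] [StarOrderedRing A]
    (hb : ∀ i, IsSelfAdjoint (b i)) (hR : ∀ i, ‖b i‖ ≤ R)
    (hc : ∀ i j, i ≠ j → 2 * R + 1 ≤ |c i - c j|)
    (hgen : (StarAlgebra.adjoin ℂ (Set.range b)).topologicalClosure = ⊤)
    (M : StarSubalgebra ℂ (CStarMatrix n n A)) (hM : IsClosed (M : Set (CStarMatrix n n A)))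
    (hdiag : diagonalHom n A (fun i => algebraMap ℝ A (c i) + b i) ∈ M)
    (hav : averaging n A ∈ M) (a : A) : scalarHom n A a ∈ M := by
  rcases isEmpty_or_nonempty n with hn | hn
  · rw [show scalarHom n A a = 0 from ext fun i => hn.elim i]
    exact zero_mem M
  have hdc : Continuous (diagonalHom n A) := map_continuous _
  have hsc : Continuous (scalarHom n A) := map_continuous _
  have hE : ∀ i, diagonalHom n A (Pi.single i 1) ∈ M :=
    single_mem_of_separated hb hR hc (M.comap (diagonalHom n A)) (hM.preimage hdc) hdiag
  have hE' : ∀ i j, matrixUnit A i j ∈ M := fun i j => by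
    rw [← diagonalHom_single_mul_averaging_mul]
    exact M.smul_mem (M.mul_mem (M.mul_mem (hE i) hav) (hE j)) _
  have hb' : ∀ i, b i ∈ M.comap (scalarHom n A) := fun i => by
    have h1 : algebraMap ℝ A (c i) + b i ∈ M.comap (scalarHom n A) := by
      change scalarHom n A _ ∈ M
      -- Matrix units copy the i-th diagonal entry of D to every diagonal position.
      rw [← sum_matrixUnit_mul_diagonalHom_mul (fun i => algebraMap ℝ A (c i) + b i) i]
      exact sum_mem fun k _ => M.mul_mem (M.mul_mem (hE' k i) hdiag) (hE' i k)
    have h2 : algebraMap ℝ A (c i) ∈ M.comap (scalarHom n A) := by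
      rw [IsScalarTower.algebraMap_apply ℝ ℂ A]
      exact algebraMap_mem _ _
    simpa using sub_mem h1 h2
  have htop : (StarAlgebra.adjoin ℂ (Set.range b)).topologicalClosure ≤ M.comap (scalarHom n A) :=
    StarSubalgebra.topologicalClosure_minimal
      (StarAlgebra.adjoin_le (by rintro _ ⟨i, rfl⟩; exact hb' i)) (hM.preimage hsc)
  exact htop (hgen ▸ StarSubalgebra.mem_top)

end CStarMatrix

/-! ### Quotient maps -/

namespace CStarQuotient

/-- The quotient map as a star homomorphism. -/
noncomputable def mkStarAlgHom {B : Type*} [CStarAlgebra B] (I : Ideal B) [I.IsTwoSided]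
    [IsClosed (I : Set B)] : B →⋆ₐ[ℂ] B ⧸ I where
  __ := Ideal.Quotient.mk I
  commutes' _ := rfl
  map_star' x := (star_mk I x).symm

@[simp]
theorem mkStarAlgHom_apply {B : Type*} [CStarAlgebra B] (I : Ideal B) [I.IsTwoSided]
    [IsClosed (I : Set B)] (x : B) : mkStarAlgHom I x = Ideal.Quotient.mk I x := rfl

theorem mkStarAlgHom_surjective {B : Type*} [CStarAlgebra B] (I : Ideal B) [I.IsTwoSided]
    [IsClosed (I : Set B)] : Function.Surjective (mkStarAlgHom I) :=
  Ideal.Quotient.mk_surjective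

theorem exists_section_of_surjective {B C : Type*} [CStarAlgebra B] [CStarAlgebra C]
    (f : B →⋆ₐ[ℂ] C) (hf : Function.Surjective f) [IsClosed (RingHom.ker f : Set B)] :
    ∃ g : C →⋆ₐ[ℂ] B ⧸ RingHom.ker f, ∀ b, g (f b) = Ideal.Quotient.mk (RingHom.ker f) b := by
  have key : ∀ b b', f b = f b' →
      mkStarAlgHom (RingHom.ker f) b = mkStarAlgHom (RingHom.ker f) b' := fun b b' h => by
    rw [mkStarAlgHom_apply, mkStarAlgHom_apply, Ideal.Quotient.eq, RingHom.mem_ker, map_sub, h,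
      sub_self]
  have hs := Function.surjInv_eq hf
  refine ⟨⟨⟨⟨⟨⟨fun c => mkStarAlgHom (RingHom.ker f) (Function.surjInv hf c), ?_⟩, ?_⟩, ?_, ?_⟩, ?_⟩,
    ?_⟩, fun b => key _ _ (hs _)⟩
  · exact (key _ 1 (by rw [hs, map_one])).trans (map_one _)
  · intro c d
    exact (key _ _ (by rw [hs, map_mul, hs, hs])).trans (map_mul _ _ _)
  · exact (key _ 0 (by rw [hs, map_zero])).trans (map_zero _)
  · intro c d
    exact (key _ _ (by rw [hs, map_add, hs, hs])).trans (map_add _ _ _)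
  · intro r
    exact (key _ (algebraMap ℂ B r) (by rw [hs, AlgHomClass.commutes])).trans
      (AlgHomClass.commutes _ r)
  · intro c
    exact (key _ _ (by rw [hs, map_star, hs])).trans (map_star _ _)

end CStarQuotient

theorem IsUCP.ofStarAlgHom_comp {A B C : Type*} [CStarAlgebra A] [PartialOrder A]
    [StarOrderedRing A] [CStarAlgebra B] [PartialOrder B] [StarOrderedRing B]
    [CStarAlgebra C] [PartialOrder C] [StarOrderedRing C] {S : OperatorSubsystem A}
    {φ : S.toSubmodule →ₗ[ℂ] B} (hφ : IsUCP S φ) (f : B →⋆ₐ[ℂ] C) :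
    IsUCP S ((f : B →ₐ[ℂ] C).toLinearMap ∘ₗ φ) where
  map_one := by simp [hφ.map_one]
  map_nonneg k M hM :=
    (CompletelyPositiveMap.ofStarAlgHom f).map_cstarMatrix_nonneg' k _ (hφ.map_nonneg k M hM)

theorem IsUCP.subtype {A : Type*} [CStarAlgebra A] [PartialOrder A] [StarOrderedRing A]
    (S : OperatorSubsystem A) : IsUCP S S.toSubmodule.subtype where
  map_one := rfl
  map_nonneg _ _ hM := hM

/-- The lifting property is phrased for literal quotients B / I, while M_N(B(H)) → M_N(Q(H)) is only
a surjective star homomorphism. Identifying its target with the quotient by its kernel bridges the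
gap. -/
theorem HasLiftingProperty.hasUCPLift {A : Type u} {B C : Type v} [CStarAlgebra A] [PartialOrder A]
    [StarOrderedRing A] [CStarAlgebra B] [PartialOrder B] [StarOrderedRing B]
    [CStarAlgebra C] [PartialOrder C] [StarOrderedRing C]
    {S : OperatorSubsystem A} (hS : HasLiftingProperty.{u, v} S) (q : B →⋆ₐ[ℂ] C)
    (hq : Function.Surjective q) (φ : S.toSubmodule →ₗ[ℂ] C) (hφ : IsUCP S φ) :
    HasUCPLift S q φ := by
  have hcl : IsClosed (RingHom.ker q : Set B) :=
    isClosed_singleton.preimage (map_continuous q : Continuous q)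
  obtain ⟨g, hg⟩ := CStarQuotient.exists_section_of_surjective q hq
  obtain ⟨ψ, hψ, hlift⟩ := hS B (RingHom.ker q) _ (hφ.ofStarAlgHom_comp g)
  refine ⟨ψ, hψ, fun s => ?_⟩
  obtain ⟨b, hb⟩ := hq (φ s)
  have : Ideal.Quotient.mk (RingHom.ker q) (ψ s) = Ideal.Quotient.mk (RingHom.ker q) b := by
    rw [hlift s, ← hg, hb]
    rfl
  rw [Ideal.Quotient.eq, RingHom.mem_ker, map_sub, sub_eq_zero] at this
  rw [this, hb]

theorem HasLiftingProperty.hasUCPLift_map {n : Type} [Fintype n] [DecidableEq n] {A : Type u}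
    {B C : Type v} [CStarAlgebra A] [PartialOrder A] [StarOrderedRing A] [CStarAlgebra B]
    [PartialOrder B] [StarOrderedRing B] [CStarAlgebra C] [PartialOrder C] [StarOrderedRing C]
    {S : OperatorSubsystem (CStarMatrix n n A)} (hS : HasLiftingProperty.{u, v} S) (q : B →⋆ₐ[ℂ] C)
    (hq : Function.Surjective q) (ρ : A →⋆ₐ[ℂ] C) :
    HasUCPLift (B := CStarMatrix n n B) S (fun T => T.map q)
      (fun s => (s : CStarMatrix n n A).map ρ) :=
  hS.hasUCPLift (CStarMatrix.mapStarAlgHom q) (CStarMatrix.mapStarAlgHom_surjective hq) _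
    ((IsUCP.subtype S).ofStarAlgHom_comp (CStarMatrix.mapStarAlgHom ρ))

/-! ### The four-dimensional operator system -/

/-- The operator system spanned by `1`, a self-adjoint element, its square and another
self-adjoint element. -/
noncomputable def OperatorSubsystem.ofSelfAdjoint {A : Type*} [CStarAlgebra A] (a p : A) (ha : IsSelfAdjoint a)
    (hp : IsSelfAdjoint p) : OperatorSubsystem A where
  toSubmodule := Submodule.span ℂ (Set.range ![1, a, a * a, p])
  one_mem' := Submodule.subset_span ⟨0, rfl⟩
  star_mem' := by
    intro x hx
    have hx' : x ∈ Submodule.span ℂ (Set.range ![1, a, a * a, p]) := hx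
    change star x ∈ Submodule.span ℂ (Set.range ![1, a, a * a, p])
    clear hx
    induction hx' using Submodule.span_induction with
    | mem x h =>
      obtain ⟨i, rfl⟩ := h
      have : star (![1, a, a * a, p] i) = ![1, a, a * a, p] i := by
        fin_cases i <;> simp [ha.star_eq, hp.star_eq]
      rw [this]
      exact Submodule.subset_span ⟨i, rfl⟩
    | zero => simp
    | add x y _ _ hx hy => rw [star_add]; exact add_mem hx hy
    | smul c x _ hx => rw [star_smul]; exact Submodule.smul_mem _ _ hx

theorem OperatorSubsystem.mem_ofSelfAdjoint {A : Type*} [CStarAlgebra A] {a p : A}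
    (ha : IsSelfAdjoint a) (hp : IsSelfAdjoint p) (i : Fin 4) :
    ![1, a, a * a, p] i ∈ (ofSelfAdjoint a p ha hp).toSubmodule :=
  Submodule.subset_span ⟨i, rfl⟩

namespace CStarMatrix

/-- An off-diagonal entry isolates the coefficient of P. The other three form a polynomial of degree
at most 2 vanishing at three distinct reals, hence are zero by divided differences. -/
theorem linearIndependent_diagonal_averaging {n A : Type*} [Fintype n] [DecidableEq n]
    [CStarAlgebra A] [Nontrivial A] (α : n → A) (x : Fin 3 → n) (t : Fin 3 → ℝ)
    (ht : Function.Injective t) (hα : ∀ i, α (x i) = algebraMap ℝ A (t i)) :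
    LinearIndependent ℂ ![1, diagonalHom n A α, diagonalHom n A α * diagonalHom n A α,
      averaging n A] := by
  rw [← map_mul, Fintype.linearIndependent_iff]
  intro g hg
  have hne : ∀ {i j}, i ≠ j → x i ≠ x j := fun {i j} hij h => hij <| ht <| by
    have := (hα i).symm.trans ((congrArg α h).trans (hα j))
    exact (algebraMap ℝ A).injective this
  have hn : (Fintype.card n : ℂ) ≠ 0 := by
    have : Nonempty n := ⟨x 0⟩
    simp
  rw [Fin.sum_univ_four] at hg
  have entry : ∀ i j, g 0 • (1 : CStarMatrix n n A) i j + g 1 • diagonalHom n A α i j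
      + g 2 • diagonalHom n A (α * α) i j + g 3 • averaging n A i j = 0 := fun i j =>
    congrFun (congrFun hg i) j
  have h3 : g 3 = 0 := by
    have := entry (x 0) (x 1)
    simpa [hne (show (0 : Fin 3) ≠ 1 by decide), diagonalHom_apply, averaging_apply, hn] using this
  have hdiag : ∀ i : Fin 3, g 0 + g 1 * t i + g 2 * (t i * t i) = 0 := by
    intro i
    have := entry (x i) (x i)
    simp only [one_apply_eq, diagonalHom_apply, if_true, h3, zero_smul, add_zero, Pi.mul_apply, hα,
      IsScalarTower.algebraMap_apply ℝ ℂ A, Complex.coe_algebraMap,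
      Algebra.algebraMap_eq_smul_one (R := ℂ) (A := A), smul_mul_smul_comm, mul_one, smul_smul,
      ← add_smul] at this
    exact (smul_eq_zero.mp this).resolve_right one_ne_zero
  have hsub : ∀ i j, i ≠ j → (t i : ℂ) - t j ≠ 0 := fun i j hij =>
    sub_ne_zero.mpr fun h => hij (ht (Complex.ofReal_injective h))
  have e : ∀ i, i ≠ 0 → g 1 + g 2 * (t 0 + t i) = 0 := fun i hi => by
    refine (mul_eq_zero.mp ?_).resolve_left (hsub i 0 hi)
    linear_combination hdiag i - hdiag 0
  have h2 : g 2 = 0 := by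
    refine (mul_eq_zero.mp ?_).resolve_left (hsub 2 1 (by decide))
    linear_combination e 2 (by decide) - e 1 (by decide)
  have h1 : g 1 = 0 := by simpa [h2] using e 1 (by decide)
  have h0 : g 0 = 0 := by simpa [h1, h2] using hdiag 0
  intro i
  fin_cases i
  exacts [h0, h1, h2, h3]

end CStarMatrix

/-- Real and imaginary parts of the generators, padded with three zeros so that three diagonal
entries of D become scalars. -/
theorem IsFinitelyGeneratedCStar.exists_selfAdjoint_generators {A : Type*} [CStarAlgebra A]
    (hA : IsFinitelyGeneratedCStar A) :
    ∃ (n : ℕ) (b : Fin (n + 3) → A), (∀ i, IsSelfAdjoint (b i)) ∧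
      (∀ i : Fin 3, b (Fin.natAdd n i) = 0) ∧
      (StarAlgebra.adjoin ℂ (Set.range b)).topologicalClosure = ⊤ := by
  classical
  obtain ⟨F, hF⟩ := hA
  let G : Finset A := F.image (fun x => (realPart x : A)) ∪ F.image (fun x => (imaginaryPart x : A))
  have hG : ∀ x ∈ G, IsSelfAdjoint x := by
    intro x hx
    simp only [G, Finset.mem_union, Finset.mem_image] at hx
    obtain ⟨y, -, rfl⟩ | ⟨y, -, rfl⟩ := hx
    exacts [(realPart y).2, (imaginaryPart y).2]
  let b : Fin (G.card + 3) → A := Fin.append (fun i => (G.equivFin.symm i : A)) 0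
  have hGb : ∀ x ∈ G, x ∈ StarAlgebra.adjoin ℂ (Set.range b) := fun x hx =>
    StarAlgebra.subset_adjoin ℂ _ ⟨Fin.castAdd 3 (G.equivFin ⟨x, hx⟩), by simp [b]⟩
  refine ⟨G.card, b, fun i => ?_, fun i => by simp [b], ?_⟩
  · induction i using Fin.addCases with
    | left i => simpa [b] using hG _ (G.equivFin.symm i).2
    | right i => simp [b]
  · refine top_le_iff.mp (hF ▸ StarSubalgebra.topologicalClosure_mono
      (StarAlgebra.adjoin_le fun x hx => ?_))
    rw [SetLike.mem_coe, ← realPart_add_I_smul_imaginaryPart x]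
    exact add_mem (hGb _ (Finset.mem_union_left _ (Finset.mem_image_of_mem _ hx)))
      (SMulMemClass.smul_mem _
        (hGb _ (Finset.mem_union_right _ (Finset.mem_image_of_mem _ hx))))

/-! ### From a lift on the matrix system to a lift of `ρ` -/

theorem Calkin.nontrivial {H : Type*} [NormedAddCommGroup H] [InnerProductSpace ℂ H]
    (hH : ¬ FiniteDimensional ℂ H) : Nontrivial (Calkin H) := by
  refine Ideal.Quotient.nontrivial_iff.mpr fun h => hH ?_
  have h1 : (1 : H →L[ℂ] H) ∈ compactOperators H := h ▸ Submodule.mem_top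
  have : LocallyCompactSpace H := isCompactOperator_id_iff_locallyCompactSpace.mp h1
  exact FiniteDimensional.of_locallyCompactSpace ℂ

/-- The hypothesis `hS` is the rigidity needed: the self-adjoint elements of S whose squares stay in
S generate all scalar matrices. They lie in the multiplicative domain of the extension modulo
compacts, which must therefore equal ρ ⊗ id on aI. -/
theorem exists_ucp_lift_of_matrix_lift {A H : Type*} [CStarAlgebra A] [PartialOrder A]
    [StarOrderedRing A] [NormedAddCommGroup H] [InnerProductSpace ℂ H] [CompleteSpace H]
    {n : Type*} [Fintype n] [DecidableEq n] [Nonempty n]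
    (ρ : A →⋆ₐ[ℂ] Calkin H) (S : OperatorSubsystem (CStarMatrix n n A))
    (hS : ∀ M : StarSubalgebra ℂ (CStarMatrix n n A), IsClosed (M : Set (CStarMatrix n n A)) →
      (∀ x ∈ S.toSubmodule, IsSelfAdjoint x → x * x ∈ S.toSubmodule → x ∈ M) →
      ∀ a, CStarMatrix.scalarHom n A a ∈ M)
    (hlift : HasUCPLift (B := CStarMatrix n n (H →L[ℂ] H)) S
      (fun T => T.map (Ideal.Quotient.mk (compactOperators H)))
      (fun s => (s : CStarMatrix n n A).map ρ)) :
    ∃ ψ : A →CP (H →L[ℂ] H), ψ 1 = 1 ∧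
      ∀ a : A, Ideal.Quotient.mk (compactOperators H) (ψ a) = ρ a := by
  obtain ⟨ψ, hψ, hψρ⟩ := hlift
  -- Arveson's theorem needs a target of the form B(K); here K = H^n, and the extension is carried
  -- back to matrices afterwards.
  let j := CStarMatrix.operatorEquiv n H
  obtain ⟨Φ₀, hΦ₀⟩ := (hψ.ofStarAlgHom_comp (j : CStarMatrix n n (H →L[ℂ] H) →⋆ₐ[ℂ]
    (PiLp 2 (fun _ : n => H) →L[ℂ] PiLp 2 (fun _ : n => H)))).exists_extension
  let Φ₁ := (CompletelyPositiveMap.ofStarAlgHom (j.symm :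
    (PiLp 2 (fun _ : n => H) →L[ℂ] PiLp 2 (fun _ : n => H)) →⋆ₐ[ℂ] CStarMatrix n n (H →L[ℂ] H))).comp Φ₀
  have hΦ₁ : ∀ s : S.toSubmodule, Φ₁ s = ψ s := fun s => by
    simp only [Φ₁, CompletelyPositiveMap.comp_apply, hΦ₀]
    exact j.symm_apply_apply _
  let σ : CStarMatrix n n A →⋆ₐ[ℂ] CStarMatrix n n (Calkin H) := CStarMatrix.mapStarAlgHom ρ
  let Φ := (CompletelyPositiveMap.ofStarAlgHom (CStarMatrix.mapStarAlgHom (n := n)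
    (CStarQuotient.mkStarAlgHom (compactOperators H)))).comp Φ₁
  have hΦ : ∀ x ∈ S.toSubmodule, Φ x = σ x := fun x hx => by
    change (Φ₁ x).map _ = x.map ρ
    rw [hΦ₁ ⟨x, hx⟩]
    exact hψρ ⟨x, hx⟩
  have h1 : Φ 1 = 1 := (hΦ 1 S.one_mem').trans (map_one σ)
  have hmem : ∀ a, CStarMatrix.scalarHom n A a ∈ CompletelyPositiveMap.agreement σ Φ :=
    hS _ (CompletelyPositiveMap.isClosed_agreement σ Φ) fun x hx hsa hsq =>
      CompletelyPositiveMap.mem_agreement_of_isSelfAdjoint h1 hsa (hΦ x hx) (hΦ _ hsq)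
  let i₀ : n := Classical.arbitrary n
  refine ⟨((CompletelyPositiveMap.entry i₀).comp Φ₁).comp
    (CompletelyPositiveMap.ofStarAlgHom (CStarMatrix.scalarHom n A)), ?_, fun a => ?_⟩
  · have : Φ₁ 1 = 1 := (hΦ₁ ⟨1, S.one_mem'⟩).trans hψ.map_one
    simp [this]
  · have := congrFun (congrFun (CompletelyPositiveMap.eq_of_mem_agreement h1 (hmem a)) i₀) i₀
    refine this.trans ?_
    simp [σ, CStarMatrix.scalarHom_apply]

theorem mainTheorem1 {A : Type u} [CStarAlgebra A] [PartialOrder A] [StarOrderedRing A]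
    {H : Type v} [NormedAddCommGroup H] [InnerProductSpace ℂ H] [CompleteSpace H]
    [TopologicalSpace.SeparableSpace H] (hH : ¬ FiniteDimensional ℂ H)
    (hA : IsFinitelyGeneratedCStar A)
    (ρ : A →⋆ₐ[ℂ] Calkin H)
    (hρ : ¬ ∃ ψ : A →CP (H →L[ℂ] H), ψ 1 = 1 ∧
      ∀ a : A, Ideal.Quotient.mk (compactOperators H) (ψ a) = ρ a) :
    ∃ n : ℕ, 1 ≤ n ∧
      ∃ S : OperatorSubsystem (CStarMatrix (Fin (n + 1)) (Fin (n + 1)) A),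
        Module.finrank ℂ S.toSubmodule = 4 ∧
        ¬ HasUCPLift (B := CStarMatrix (Fin (n + 1)) (Fin (n + 1)) (H →L[ℂ] H)) S
            (fun T => T.map (Ideal.Quotient.mk (compactOperators H)))
            (fun s => (s : CStarMatrix (Fin (n + 1)) (Fin (n + 1)) A).map ρ) ∧
        ¬ HasLiftingProperty.{u, v} S := by
  have hQ := Calkin.nontrivial hH
  have hAn : Nontrivial A := RingHom.domain_nontrivial (ρ : A →+* Calkin H)
  obtain ⟨m, b, hb, hb0, hgen⟩ := hA.exists_selfAdjoint_generators
  let R : ℝ := ∑ i, ‖b i‖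
  have hR : ∀ i, ‖b i‖ ≤ R := fun i =>
    Finset.single_le_sum (f := fun i => ‖b i‖) (fun _ _ => norm_nonneg _) (Finset.mem_univ i)
  have hR0 : 0 ≤ R := Finset.sum_nonneg fun _ _ => norm_nonneg _
  -- Multiples of 2R + 1, with R bounding every ‖b_i‖, are separated enough for the spectra of the
  -- entries.
  let c : Fin (m + 2 + 1) → ℝ := fun i => (i : ℝ) * (2 * R + 1)
  have hc : ∀ i j, i ≠ j → 2 * R + 1 ≤ |c i - c j| := by
    intro i j hij
    have h1 : (1 : ℝ) ≤ |(i : ℝ) - (j : ℝ)| := by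
      have : (i : ℤ) - j ≠ 0 := sub_ne_zero.mpr fun h => hij (Fin.ext (by exact_mod_cast h))
      exact_mod_cast Int.one_le_abs this
    rw [← sub_mul, abs_mul, abs_of_pos (by positivity : 0 < 2 * R + 1)]
    nlinarith
  have hcinj : Function.Injective c := fun i j hij => by
    by_contra h
    have := hc i j h
    rw [hij, sub_self, abs_zero] at this
    linarith
  let α : Fin (m + 2 + 1) → A := fun i => algebraMap ℝ A (c i) + b i
  let D := CStarMatrix.diagonalHom (Fin (m + 2 + 1)) A α
  let P := CStarMatrix.averaging (Fin (m + 2 + 1)) A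
  have hD : IsSelfAdjoint D := by
    have : IsSelfAdjoint α := funext fun i =>
      (IsSelfAdjoint.algebraMap A (IsSelfAdjoint.all (c i))).add (hb i)
    exact this.map _
  have hP : IsSelfAdjoint P := CStarMatrix.isSelfAdjoint_averaging
  let S := OperatorSubsystem.ofSelfAdjoint D P hD hP
  have hmem := OperatorSubsystem.mem_ofSelfAdjoint hD hP
  have hno : ¬ HasUCPLift (B := CStarMatrix (Fin (m + 2 + 1)) (Fin (m + 2 + 1)) (H →L[ℂ] H)) S
      (fun T => T.map (Ideal.Quotient.mk (compactOperators H)))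
      (fun s => (s : CStarMatrix (Fin (m + 2 + 1)) (Fin (m + 2 + 1)) A).map ρ) := fun hlift =>
    hρ <| exists_ucp_lift_of_matrix_lift ρ S (fun M hM hSM =>
      CStarMatrix.scalarHom_mem_of_generators hb hR hc hgen M hM (hSM D (hmem 1) hD (hmem 2))
        (hSM P (hmem 3) hP (by rw [CStarMatrix.averaging_mul_self]; exact hmem 3))) hlift
  -- The matrix size is m + 3: m generators and three zeros.
  refine ⟨m + 2, by omega, S, ?_, hno, fun hLP => hno ?_⟩
  · have := CStarMatrix.linearIndependent_diagonal_averaging α (fun i => Fin.natAdd m i)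
      (fun i => c (Fin.natAdd m i)) (fun i j h => Fin.natAdd_injective 3 m (hcinj h))
      (fun i => by simp [α, hb0])
    exact (finrank_span_eq_card this).trans (by simp)
  · exact hLP.hasUCPLift_map (CStarQuotient.mkStarAlgHom (compactOperators H))
      (CStarQuotient.mkStarAlgHom_surjective _) ρ
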